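/- Let $E_X$ be a second countable locally compact Hausdorff space with its Borel $\sigma$-field, $\pi_X$ a probability measure on $E_X$, and $\mathcal H_X$ a separable RKHS on $E_X$ with kernel $k_X$, such that for $\pi_X$-almost all $x$ the function $k_X(\cdot,x)$ is measurable and $k_X(x,x)\le\kappa_X^2$. Write $\phi_X(x)=k_X(\cdot,x)$, let $I_X:\mathcal H_X\to L_2(X):=L_2(\pi_X)$, $f\mapsto[f]$, be the embedding, $L_X=I_XI_X^*$ and $C_X=I_X^*I_X$. Assume that $L_X$ has infinitely many positive eigenvalues $\mu_1\ge\mu_2\ge\dots>0$ (with multiplicity) and that $$c_3\,i^{-1/p_X}\le\mu_i\le c_2\,i^{-1/p_X}\qquad(i\ge1)\qquad\text{(EVDX+)}$$ for some $c_2,c_3>0$ and $0<p_X\le1$. Let $\gamma_1\ge1$, $R_1>0$, $\beta_X\ge1$ and $\sigma,L,B_X>0$. Then there exist constants $J_0,J,\theta>0$ such that the following holds for every second countable locally compact Hausdorff space $E_Z$ and every joint law of $(X,Z)$ on $E_X\times E_Z$, given by a law $\pi_Z$ of $Z$ and a Markov kernel $p(z,dx)$ for $X$ given $Z=z$, that has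 $X$-marginal $\pi_X$ and satisfies (i) completeness: $\mathcal T:L_2(X)\to L_2(Z)$, $\mathcal Th=\mathbb E[h(X)\mid Z]$, is injective; (ii) the link condition with $\gamma_1$: $\|C_F^{1/2}f\|_{\mathcal H_X}\le R_1\|C_X^{\gamma_1/2}f\|_{\mathcal H_X}$ for all $f\in\mathcal H_X$, where $C_F=\mathbb E[F_*(Z)\otimes F_*(Z)]$ and $F_*(z)=\int\phi_X(x)\,p(z,dx)$. For every measurable learning method $D=\{(x_i,z_i,y_i)\}_{i=1}^n\mapsto\hat h_D\in L_2(X)$, every $\tau>0$ and all sufficiently large $n$, there is a law $P$ of $(X,Z,Y)$ with the given joint law of $(X,Z)$ that is an NPIV model, i.e. $\mathbb E|Y|<\infty$ and $Y=h_0(X)+U$ with $h_0\in L_2(X)$ and $\mathbb E[U\mid Z]=0$, whose minimum-norm solution $h_*$ (the element of least norm of $\{h\in\mathcal H_X:\mathbb E[h(X)\mid Z]=\mathbb E[Y\mid Z]\}$) exists and satisfies $$\|L_X^{-\beta_X/2}h_*\|_{L_2(X)}\le B_X\qquad\text{(SRCX)},$$ $$\mathbb E\big[|Y-\mathbb E[h_*(X)\mid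 Z]|^m\,\big|\,Z\big]\le\tfrac12\,m!\,\sigma^2L^{m-2}\quad\text{for all integers } m\ge2\qquad\text{(MOM)},$$ and such that, with $P^n$-probability at least $1-J_0\tau^{1/\theta}$, $$\|\hat h_D-h_*\|_{L_2(X)}^2\ \ge\ \tau^2\,J\,n^{-\frac{\beta_X}{\beta_X+\gamma_1-1+p_X}}.$$ -/

import Mathlib

open MeasureTheory ProbabilityTheory Filter
open scoped ENNReal InnerProductSpace

universe u v w

namespace NPIV

noncomputable section

/-! ### Reproducing kernel Hilbert spaces and their embedding into `L²` -/

section Kernel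

variable {EX : Type*} [MeasurableSpace EX]
variable {H : Type*} [NormedAddCommGroup H] [InnerProductSpace ℝ H] [CompleteSpace H]
  [RKHS ℝ H EX ℝ]

/-- The canonical feature map `φ_X(x) = k_X(·, x) ∈ H_X`. -/
def feature (H : Type*) [NormedAddCommGroup H] [InnerProductSpace ℝ H] [CompleteSpace H]
    [RKHS ℝ H EX ℝ] (x : EX) : H := RKHS.kerFun H x (1 : ℝ)

/-- The scalar reproducing kernel `k_X(x, y)` of `H_X`. -/
def scalarKernel (H : Type*) [NormedAddCommGroup H] [InnerProductSpace ℝ H] [CompleteSpace H]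
    [RKHS ℝ H EX ℝ] (x y : EX) : ℝ := feature H y x

/-- The technical assumptions on the kernel `k_X` and the law `π_X`: `H_X` is separable,
`k_X(·, x)` is measurable and `k_X(x, x) ≤ κ_X²` for `π_X`-almost all `x`. -/
structure KernelAssumptions (H : Type*) [NormedAddCommGroup H] [InnerProductSpace ℝ H]
    [CompleteSpace H] [RKHS ℝ H EX ℝ] (πX : Measure EX) (κX : ℝ) : Prop where
  separable : TopologicalSpace.SeparableSpace H
  measurable : ∀ᵐ x ∂πX, Measurable (fun y => scalarKernel H y x)
  bounded : ∀ᵐ x ∂πX, scalarKernel H x x ≤ κX ^ 2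

set_option linter.unusedSectionVars false

theorem inner_feature (x : EX) (f : H) : ⟪feature H x, f⟫_ℝ = f x := by
  simp [feature]

theorem ae_bound {πX : Measure EX} {κX : ℝ} (hk : KernelAssumptions H πX κX) (f : H) :
    ∀ᵐ x ∂πX, ‖f x‖ ≤ |κX| * ‖f‖ := by
  filter_upwards [hk.bounded] with x hx
  have h1 : ‖feature H x‖ ^ 2 ≤ κX ^ 2 := by
    rw [← real_inner_self_eq_norm_sq, inner_feature]
    exact hx
  have h2 : ‖feature H x‖ ≤ |κX| := by
    simpa using sq_le_sq.mp h1
  rw [← inner_feature x f]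
  exact (norm_inner_le_norm _ _).trans (mul_le_mul_of_nonneg_right h2 (norm_nonneg _))

/-- The measurable elements of `H_X`, as a subspace. -/
def measurableSubmodule (H : Type*) [NormedAddCommGroup H] [InnerProductSpace ℝ H]
    [RKHS ℝ H EX ℝ] : Submodule ℝ H where
  carrier := {g | Measurable (fun x => g x)}
  add_mem' := by
    intro a b ha hb
    change Measurable (fun x => (a + b : H) x)
    have : (fun x => (a + b : H) x) = (fun x => a x) + fun x => b x := by ext x; simp
    rw [this]
    exact Measurable.add ha hb
  zero_mem' := by
    change Measurable (fun x => (0 : H) x)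
    have : (fun x => (0 : H) x) = fun _ : EX => (0 : ℝ) := by ext x; simp
    rw [this]
    exact measurable_const
  smul_mem' := by
    intro c a ha
    change Measurable (fun x => (c • a : H) x)
    have : (fun x => (c • a : H) x) = fun x => c * a x := by ext x; simp
    rw [this]
    exact Measurable.const_mul ha c

theorem isClosed_measurableSubmodule :
    IsClosed (measurableSubmodule H : Set H) := by
  refine IsSeqClosed.isClosed ?_
  intro g f hg hgf
  refine measurable_of_tendsto_metrizable (f := fun n x => g n x) (fun n => hg n) ?_
  rw [tendsto_pi_nhds]
  intro x
  exact ((RKHS.continuous_eval (H := H) x).tendsto f).comp hgf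

theorem aemeasurable_coe {πX : Measure EX} {κX : ℝ} (hk : KernelAssumptions H πX κX) (f : H) :
    AEMeasurable (fun x => f x) πX := by
  set S : Submodule ℝ H := (Submodule.span ℝ
    {g | ∃ x : EX, Measurable (fun y => scalarKernel H y x) ∧ g = feature H x}).topologicalClosure
    with hS
  have hle : S ≤ measurableSubmodule H := by
    refine Submodule.topologicalClosure_minimal _ ?_ isClosed_measurableSubmodule
    rw [Submodule.span_le]
    rintro g ⟨x, hx, rfl⟩
    exact hx
  have : CompleteSpace S := (Submodule.isClosed_topologicalClosure _).completeSpace_coe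
  refine ⟨fun x => (S.starProjection f) x, hle (Submodule.starProjection_apply_mem S f), ?_⟩
  filter_upwards [hk.measurable] with x hx
  have hmem : feature H x ∈ S :=
    Submodule.le_topologicalClosure _ (Submodule.subset_span ⟨x, hx, rfl⟩)
  have h0 : ⟪feature H x, f - S.starProjection f⟫_ℝ = 0 :=
    (Submodule.mem_orthogonal _ _).mp (Submodule.sub_starProjection_mem_orthogonal f) _ hmem
  rw [inner_sub_right, inner_feature, inner_feature] at h0
  linarith

theorem memLp_coe {πX : Measure EX} [IsFiniteMeasure πX] {κX : ℝ}
    (hk : KernelAssumptions H πX κX) (f : H) : MemLp (fun x => f x) 2 πX :=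
  MemLp.of_bound (aemeasurable_coe hk f).aestronglyMeasurable _ (ae_bound hk f)

/-- The embedding `I_X : H_X → L²(X)`, `f ↦ [f]_X`. -/
def embX {πX : Measure EX} [IsProbabilityMeasure πX] {κX : ℝ}
    (hk : KernelAssumptions H πX κX) : H →L[ℝ] Lp ℝ 2 πX :=
  LinearMap.mkContinuous
    { toFun := fun f => (memLp_coe hk f).toLp (fun x => f x)
      map_add' := by
        intro f g
        rw [← MemLp.toLp_add]
        congr 1
        ext x
        simp
      map_smul' := by
        intro c f
        rw [RingHom.id_apply, ← MemLp.toLp_const_smul]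
        congr 1
        ext x
        simp }
    |κX| (by
      intro f
      have hb : ∀ᵐ x ∂πX, ‖(memLp_coe hk f).toLp (fun x => f x) x‖ ≤ |κX| * ‖f‖ := by
        filter_upwards [ae_bound hk f, (memLp_coe hk f).coeFn_toLp] with x h1 h2
        rw [h2]
        exact h1
      have hle := Lp.norm_le_of_ae_bound (by positivity) hb
      have h1 : ((measureUnivNNReal πX : ℝ)) = 1 := by simp [measureUnivNNReal]
      rw [h1, Real.one_rpow, one_mul] at hle
      exact hle)

/-- `S_X = I_X^* : L²(X) → H_X`. -/
def adjX {πX : Measure EX} [IsProbabilityMeasure πX] {κX : ℝ}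
    (hk : KernelAssumptions H πX κX) : Lp ℝ 2 πX →L[ℝ] H :=
  ContinuousLinearMap.adjoint (embX hk)

/-- The integral operator `L_X = I_X S_X` on `L²(X)`. -/
def opL {πX : Measure EX} [IsProbabilityMeasure πX] {κX : ℝ}
    (hk : KernelAssumptions H πX κX) : Lp ℝ 2 πX →L[ℝ] Lp ℝ 2 πX :=
  embX hk ∘L adjX hk

/-- The covariance operator `C_X = S_X I_X` on `H_X`. -/
def opC {πX : Measure EX} [IsProbabilityMeasure πX] {κX : ℝ}
    (hk : KernelAssumptions H πX κX) : H →L[ℝ] H :=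
  adjX hk ∘L embX hk

/-- `(μ_i, e_i)_{i ∈ ℕ}` is a spectral representation of `L_X` and `C_X` with infinitely many
positive eigenvalues, listed in non-increasing order and with multiplicity (the index starts
at `0`). -/
structure IsSpectralSystem {πX : Measure EX} [IsProbabilityMeasure πX] {κX : ℝ}
    (hk : KernelAssumptions H πX κX) (μ : ℕ → ℝ) (e : ℕ → H) : Prop where
  pos : ∀ i, 0 < μ i
  antitone : Antitone μ
  orthonormal_L2 : Orthonormal ℝ (fun i => embX hk (e i))
  dense_L2 : (Submodule.span ℝ (Set.range fun i => embX hk (e i))).topologicalClosure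
    = (LinearMap.range (embX hk : H →ₗ[ℝ] Lp ℝ 2 πX)).topologicalClosure
  orthonormal_H : Orthonormal ℝ (fun i => Real.sqrt (μ i) • e i)
  dense_H : (Submodule.span ℝ (Set.range fun i => Real.sqrt (μ i) • e i)).topologicalClosure
    = (LinearMap.ker (embX hk : H →ₗ[ℝ] Lp ℝ 2 πX))ᗮ
  opL_eq : ∀ g : Lp ℝ 2 πX,
    HasSum (fun i => (μ i * ⟪embX hk (e i), g⟫_ℝ) • embX hk (e i)) (opL hk g)
  opC_eq : ∀ f : H,
    HasSum (fun i => (μ i * ⟪Real.sqrt (μ i) • e i, f⟫_ℝ) • (Real.sqrt (μ i) • e i)) (opC hk f)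

/-- Two-sided polynomial eigenvalue decay: `c₃ i^{-1/p} ≤ μ_i ≤ c₂ i^{-1/p}` for all `i ≥ 1`
(the sequence `μ` is indexed from `0`). -/
def EigenvalueDecay (μ : ℕ → ℝ) (c₂ c₃ p : ℝ) : Prop :=
  ∀ i : ℕ, c₃ * ((i : ℝ) + 1) ^ (-(1 / p)) ≤ μ i ∧ μ i ≤ c₂ * ((i : ℝ) + 1) ^ (-(1 / p))

/-- The power `A^s f = ∑ᵢ μᵢ^s ⟨vᵢ, f⟩ vᵢ`, `s > 0`, of the operator
`A = ∑ᵢ μᵢ ⟨vᵢ, ·⟩ vᵢ` with `v` orthonormal and `μ` positive and bounded. -/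
def fracPow {E : Type*} [NormedAddCommGroup E] [InnerProductSpace ℝ E]
    (μ : ℕ → ℝ) (v : ℕ → E) (s : ℝ) (f : E) : E :=
  ∑' i, ((μ i) ^ s * ⟪v i, f⟫_ℝ) • v i

/-- The interpolation norm `‖g‖_β = ‖L_X^{-β/2} g‖_{L²(X)}`, `β > 0`, with value `∞` if `g` is not
in the range `[H_X]^β` of `L_X^{β/2}`. The preimage of `g` under `L_X^{β/2}` that is orthogonal to
the kernel is the one of least norm. -/
def interpNorm {πX : Measure EX} [IsProbabilityMeasure πX] {κX : ℝ}
    (hk : KernelAssumptions H πX κX) (μ : ℕ → ℝ) (e : ℕ → H) (β : ℝ) (g : Lp ℝ 2 πX) : ℝ≥0∞ :=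
  ⨅ (u : Lp ℝ 2 πX) (_ : fracPow μ (fun i => embX hk (e i)) (β / 2) u = g), ‖u‖ₑ

end Kernel

/-! ### Conditional expectations given the instrument

The joint law of `(X, Z)` is given by the law `πZ` of `Z` and the Markov kernel `p`, where `p z` is
the law of `X` given `Z = z`. -/

section Instrument

variable {EX : Type*} [MeasurableSpace EX] {EZ : Type*} [MeasurableSpace EZ]

/-- `(𝒯 h)(z) = E[h(X) | Z = z] = ∫ h(x) p(z, dx)`. -/
def condMean (p : Kernel EZ EX) (h : EX → ℝ) (z : EZ) : ℝ := ∫ x, h x ∂(p z)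

/-- Completeness: `𝒯 : L²(X) → L²(Z)` is injective. -/
def Completeness (πX : Measure EX) (πZ : Measure EZ) (p : Kernel EZ EX) : Prop :=
  ∀ g₁ g₂ : Lp ℝ 2 πX, condMean p g₁ =ᵐ[πZ] condMean p g₂ → g₁ = g₂

/-- The conditional mean embedding `F_*(z) = ∫ φ_X(x) p(z, dx) ∈ H_X`. -/
def meanEmbedding (H : Type*) [NormedAddCommGroup H] [InnerProductSpace ℝ H] [CompleteSpace H]
    [RKHS ℝ H EX ℝ] (p : Kernel EZ EX) (z : EZ) : H :=
  ∫ x, feature H x ∂(p z)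

/-- The covariance operator `C_F = E[F_*(Z) ⊗ F_*(Z)]` on `H_X`. -/
def opF (H : Type*) [NormedAddCommGroup H] [InnerProductSpace ℝ H] [CompleteSpace H]
    [RKHS ℝ H EX ℝ] (πZ : Measure EZ) (p : Kernel EZ EX) : H →L[ℝ] H :=
  ∫ z, InnerProductSpace.rankOne ℝ (meanEmbedding H p z) (meanEmbedding H p z) ∂πZ

/-- The part of the link condition that involves `γ₁`:
`‖C_F^{1/2} f‖ ≤ R₁ ‖C_X^{γ₁/2} f‖` for all `f ∈ H_X`. As `C_F` is positive,
`‖C_F^{1/2} f‖² = ⟨C_F f, f⟩`. -/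
def UpperLink {H : Type*} [NormedAddCommGroup H] [InnerProductSpace ℝ H] [CompleteSpace H]
    [RKHS ℝ H EX ℝ] (μ : ℕ → ℝ) (e : ℕ → H) (πZ : Measure EZ) (p : Kernel EZ EX)
    (γ₁ R₁ : ℝ) : Prop :=
  ∀ f : H, Real.sqrt ⟪opF H πZ p f, f⟫_ℝ
    ≤ R₁ * ‖fracPow μ (fun i => Real.sqrt (μ i) • e i) (γ₁ / 2) f‖

/-! ### The NPIV model

The law of `(X, Z, Y)` is a measure on `EX × EZ × ℝ`. -/

/-- The σ-algebra generated by `Z` on `EX × EZ × ℝ`. -/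
abbrev sigmaZ (EX EZ : Type*) [MeasurableSpace EZ] : MeasurableSpace (EX × EZ × ℝ) :=
  MeasurableSpace.comap (fun w : EX × EZ × ℝ => w.2.1) inferInstance

/-- `P` is the law of a triple `(X, Z, Y)` with `Y = h₀(X) + U`, `E[U | Z] = 0`, `h₀ ∈ L²(X)`, and
with `(X, Z)` distributed according to `πZ` and `p`. -/
structure IsNPIVModel (πX : Measure EX) (πZ : Measure EZ) (p : Kernel EZ EX)
    (P : Measure (EX × EZ × ℝ)) (h₀ : EX → ℝ) : Prop where
  prob : IsProbabilityMeasure P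
  law_XZ : P.map (fun w => (w.2.1, w.1)) = πZ ⊗ₘ p
  law_X : P.map (fun w => w.1) = πX
  memLp : MemLp h₀ 2 πX
  integrable : Integrable (fun w => w.2.2) P
  condExp_noise : P[fun w => w.2.2 - h₀ w.1 | sigmaZ EX EZ] =ᵐ[P] 0

/-- The solutions `h ∈ H_X` of `𝒯 h = r₀`, where `r₀(Z) = E[Y | Z]`. -/
def solutionSet (H : Type*) [NormedAddCommGroup H] [InnerProductSpace ℝ H]
    [RKHS ℝ H EX ℝ] (p : Kernel EZ EX) (P : Measure (EX × EZ × ℝ)) : Set H :=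
  {h | P[fun w => w.2.2 | sigmaZ EX EZ] =ᵐ[P] fun w => condMean p h w.2.1}

/-- `h` is the solution of least `H_X`-norm. -/
def IsMinNormSolution {H : Type*} [NormedAddCommGroup H] [InnerProductSpace ℝ H]
    [RKHS ℝ H EX ℝ] (p : Kernel EZ EX) (P : Measure (EX × EZ × ℝ)) (h : H) : Prop :=
  h ∈ solutionSet H p P ∧ ∀ h' ∈ solutionSet H p P, ‖h‖ ≤ ‖h'‖

/-- The Bernstein moment condition
`E[|Y - E[h(X) | Z]|^m | Z] ≤ ½ m! σ² L^{m-2}` for all `m ≥ 2`. -/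
def MomentCondition (p : Kernel EZ EX) (P : Measure (EX × EZ × ℝ)) (h : EX → ℝ)
    (σ L : ℝ) : Prop :=
  ∀ m : ℕ, 2 ≤ m →
    Integrable (fun w => |w.2.2 - condMean p h w.2.1| ^ m) P ∧
    ∀ᵐ w ∂P, (P[fun w => |w.2.2 - condMean p h w.2.1| ^ m | sigmaZ EX EZ]) w
      ≤ 1 / 2 * (m.factorial : ℝ) * σ ^ 2 * L ^ (m - 2)

end Instrument

end

end NPIV

open NPIV

/-! ### Change of measure -/

/-! The bound comes from `2 ^ m` alternatives that n observations cannot tell apart. Take h_ω = ε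
∑_{i<m} ω_i e_{m+i} with ω ∈ {0,1}^m. These functions live on the block m ≤ j < 2m, where all
eigenvalues are comparable to m^{-1/p_X}. With ε² ≍ b² m^{-β_X/p_X - 1} the source condition holds
with radius b, while a squared error of order m in ω becomes ε² m ≍ m^{-β_X/p_X} in L². The response
takes the values ±s with conditional mean (𝒯 h_ω)(Z). It is bounded, which gives the moment
condition, and h_ω is the minimum-norm solution by completeness and orthogonality to the kernel of
the embedding.

All alternatives have a density with respect to the law in which the response is a fair coin. For n
observations the second moment of this density is at most exp(n E[(𝒯 h_ω)(Z)²] / s²)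
(`lintegral_tilt_sq_le`). The link condition gives E[(𝒯 h_ω)(Z)²] ≲ b² m^{-(β_X+γ₁-1)/p_X}. For m ≍
n^{p_X/D}, D = β_X+γ₁-1+p_X, and b small, the second moment is therefore at most ρ^{-m}, where ρ < 1
is the constant `cubeRate`.

By Bessel's inequality the estimator may be replaced by a point of ℝ^m. Any such point is within
squared distance m/16 of at most (2ρ⁴)^m vertices (`card_cube_near_le`), so some vertex is
approached with probability at most ρ^{4m} under the coin law. Changing the measure raises this to
at most 2ρ^m under that alternative (`exists_cube_vertex_pi_tiltedLaw_le`). As m → ∞ this falls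
below every τ. -/

theorem withDensity_apply_le_add {Ω : Type*} [MeasurableSpace Ω] (P : Measure Ω)
    {ℓ : Ω → ℝ≥0∞} (hℓ : Measurable ℓ) {B : Set Ω} (hB : MeasurableSet B) {a : ℝ≥0∞}
    (ha : a ≠ 0) (ha' : a ≠ ∞) :
    (P.withDensity ℓ) B ≤ a * ∫⁻ x, ℓ x ^ 2 ∂P + a⁻¹ * P B := by
  -- A linearised Cauchy–Schwarz inequality: where a t ≥ 1 the quadratic term dominates t, elsewhere
  -- the constant does.
  have key : ∀ t : ℝ≥0∞, t ≤ a * t ^ 2 + a⁻¹ := by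
    intro t
    rcases le_total 1 (a * t) with h | h
    · calc t = 1 * t := (one_mul t).symm
        _ ≤ (a * t) * t := by gcongr
        _ = a * t ^ 2 := by ring
        _ ≤ _ := le_self_add
    · have : t ≤ a⁻¹ := by
        rw [← one_div, ENNReal.le_div_iff_mul_le (Or.inl ha) (Or.inl ha'), mul_comm]
        exact h
      exact this.trans le_add_self
  rw [withDensity_apply _ hB]
  calc ∫⁻ x in B, ℓ x ∂P ≤ ∫⁻ x in B, (a * ℓ x ^ 2 + a⁻¹) ∂P := lintegral_mono fun x => key _
    _ = a * ∫⁻ x in B, ℓ x ^ 2 ∂P + a⁻¹ * P B := by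
      rw [lintegral_add_right _ measurable_const, lintegral_const_mul _ (hℓ.pow_const 2),
        setLIntegral_const]
    _ ≤ _ := by
      gcongr
      exact Measure.restrict_le_self

/-- If every observation lies in at most `N` of the events `B i`, then some `B i` is unlikely
under the alternative with density `ℓ i`. -/
theorem exists_withDensity_apply_le {Ω ι : Type*} [MeasurableSpace Ω] [Fintype ι] [Nonempty ι]
    (P : Measure Ω) [IsProbabilityMeasure P] {ℓ : ι → Ω → ℝ≥0∞} (hℓ : ∀ i, Measurable (ℓ i))
    {B : ι → Set Ω} (hB : ∀ i, MeasurableSet (B i)) {a V N : ℝ≥0∞} (ha : a ≠ 0) (ha' : a ≠ ∞)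
    (hV : ∀ i, ∫⁻ x, ℓ i x ^ 2 ∂P ≤ V)
    (hN : ∀ x, ∑ i, (B i).indicator (1 : Ω → ℝ≥0∞) x ≤ N) :
    ∃ i, (P.withDensity (ℓ i)) (B i) ≤ a * V + a⁻¹ * (N / Fintype.card ι) := by
  have hc0 : (Fintype.card ι : ℝ≥0∞) ≠ 0 := by simp
  have hct : (Fintype.card ι : ℝ≥0∞) ≠ ∞ := ENNReal.natCast_ne_top _
  have hsum : ∑ i, P (B i) ≤ N := by
    calc ∑ i, P (B i) = ∑ i, ∫⁻ x, (B i).indicator 1 x ∂P := by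
          simp_rw [lintegral_indicator_one (hB _)]
      _ = ∫⁻ x, ∑ i, (B i).indicator 1 x ∂P :=
          (lintegral_finsetSum _ fun i _ => measurable_one.indicator (hB i)).symm
      _ ≤ ∫⁻ _, N ∂P := lintegral_mono hN
      _ = N := by simp
  -- Pigeonhole: the probabilities sum to at most N, so one of them is at most the average.
  obtain ⟨i, hi⟩ : ∃ i, P (B i) ≤ N / Fintype.card ι := by
    by_contra! h
    have h1 : ∑ _i : ι, N / (Fintype.card ι : ℝ≥0∞) < ∑ i, P (B i) :=
      ENNReal.sum_lt_sum_of_nonempty Finset.univ_nonempty fun i _ => h i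
    rw [Finset.sum_const, Finset.card_univ, nsmul_eq_mul, ENNReal.mul_div_cancel hc0 hct] at h1
    exact absurd hsum (not_le.2 h1)
  refine ⟨i, (withDensity_apply_le_add P (hℓ i) (hB i) ha ha').trans ?_⟩
  gcongr
  exact hV i

theorem lintegral_pi_prod {ι E : Type*} [Fintype ι] [MeasurableSpace E] (P : Measure E)
    [IsProbabilityMeasure P] {f : ι → E → ℝ≥0∞} (hf : ∀ i, Measurable (f i)) :
    ∫⁻ x, ∏ i, f i (x i) ∂(Measure.pi fun _ : ι => P) = ∏ i, ∫⁻ y, f i y ∂P := by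
  have h := lintegral_prod_eq_prod_lintegral_of_indepFun (μ := Measure.pi fun _ : ι => P)
    Finset.univ (fun i (x : ι → E) => f i (x i))
    (iIndepFun_pi (μ := fun _ : ι => P) (X := fun i => f i) fun i => (hf i).aemeasurable)
    (fun i => (hf i).comp (measurable_pi_apply i))
  rw [h]
  refine Finset.prod_congr rfl fun i _ => ?_
  exact (measurePreserving_eval (fun _ : ι => P) i).lintegral_comp (hf i)

/-- The likelihood ratio of an i.i.d. sample factorises, so all alternatives can be compared with
one product of coin laws. -/
theorem pi_withDensity {ι E : Type*} [Fintype ι] [MeasurableSpace E] (P : Measure E)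
    [IsProbabilityMeasure P] {ℓ : E → ℝ≥0∞} (hℓ : Measurable ℓ)
    [IsProbabilityMeasure (P.withDensity ℓ)] :
    (Measure.pi fun _ : ι => P.withDensity ℓ)
      = (Measure.pi fun _ : ι => P).withDensity fun x => ∏ i, ℓ (x i) := by
  refine Measure.pi_eq fun s hs => ?_
  rw [withDensity_apply _ (MeasurableSet.univ_pi hs), ← lintegral_indicator (MeasurableSet.univ_pi hs)]
  have : (Set.univ.pi s).indicator (fun x : ι → E => ∏ i, ℓ (x i))
      = fun x => ∏ i, (s i).indicator ℓ (x i) := by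
    classical
    ext x
    by_cases hx : x ∈ Set.univ.pi s
    · rw [Set.indicator_of_mem hx]
      exact Finset.prod_congr rfl fun i _ => (Set.indicator_of_mem (hx i trivial) _).symm
    · rw [Set.indicator_of_notMem hx]
      simp only [Set.mem_pi, Set.mem_univ, true_imp_iff, not_forall] at hx
      obtain ⟨i, hi⟩ := hx
      exact (Finset.prod_eq_zero (Finset.mem_univ i) (Set.indicator_of_notMem hi _)).symm
  rw [this, lintegral_pi_prod P fun i => hℓ.indicator (hs i)]
  exact Finset.prod_congr rfl fun i _ => by
    rw [lintegral_indicator (hs i), withDensity_apply _ (hs i)]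

/-! ### Vertices of a cube near a given point -/

/-- The coordinate `0` or `1` of a vertex of the unit cube. -/
def bit (b : Bool) : ℝ := if b then 1 else 0

/-- Every real number has distance at least 1/2 from 0 or from 1. The rate 4 log 2 makes the
corresponding term at most 1/2; the other is at most 1. -/
theorem sum_bool_exp_le (a : ℝ) :
    ∑ b : Bool, Real.exp (-(4 * Real.log 2) * (a - bit b) ^ 2) ≤ 3 / 2 := by
  have hl : 0 < Real.log 2 := Real.log_pos (by norm_num)
  have hone : ∀ x : ℝ, Real.exp (-(4 * Real.log 2) * x ^ 2) ≤ 1 := fun x => by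
    rw [Real.exp_le_one_iff]
    nlinarith [mul_nonneg hl.le (sq_nonneg x)]
  have hhalf : ∀ x : ℝ, 1 / 4 ≤ x ^ 2 → Real.exp (-(4 * Real.log 2) * x ^ 2) ≤ 1 / 2 := by
    intro x hx
    have : (1 / 2 : ℝ) = Real.exp (-Real.log 2) := by
      rw [Real.exp_neg, Real.exp_log (by norm_num)]; norm_num
    rw [this, Real.exp_le_exp]
    nlinarith
  simp only [Fintype.sum_bool, bit, if_true, Bool.false_eq_true, if_false]
  rcases le_total a (1 / 2) with h | h
  · linarith [hhalf (a - 1) (by nlinarith), hone (a - 0)]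
  · linarith [hhalf (a - 0) (by nlinarith), hone (a - 1)]

-- A Chernoff bound: for a nearby vertex exp(4 log 2 · (m/16 - dist²)) ≥ 1. The sum of these weights
-- over the whole cube factorises over the coordinates.
open Classical in
theorem card_cube_near_le {m : ℕ} (a : Fin m → ℝ) :
    ((Finset.univ.filter fun ω : Fin m → Bool =>
      ∑ i, (a i - bit (ω i)) ^ 2 < m / 16).card : ℝ)
      ≤ (Real.exp (Real.log 2 / 4) * (3 / 2)) ^ m := by
  have hl : 0 < Real.log 2 := Real.log_pos (by norm_num)
  set S := Finset.univ.filter fun ω : Fin m → Bool => ∑ i, (a i - bit (ω i)) ^ 2 < m / 16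
  calc (S.card : ℝ) = ∑ ω ∈ S, (1 : ℝ) := by simp
    _ ≤ ∑ ω ∈ S, Real.exp (Real.log 2 / 4) ^ m
          * ∏ i, Real.exp (-(4 * Real.log 2) * (a i - bit (ω i)) ^ 2) := by
        refine Finset.sum_le_sum fun ω hω => ?_
        have hω' : ∑ i, (a i - bit (ω i)) ^ 2 < m / 16 := (Finset.mem_filter.1 hω).2
        rw [← Real.exp_sum, ← Finset.mul_sum, ← Real.exp_nat_mul, ← Real.exp_add,
          Real.one_le_exp_iff]
        nlinarith
    _ ≤ ∑ ω : Fin m → Bool, Real.exp (Real.log 2 / 4) ^ m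
          * ∏ i, Real.exp (-(4 * Real.log 2) * (a i - bit (ω i)) ^ 2) :=
        Finset.sum_le_sum_of_subset_of_nonneg (Finset.subset_univ _)
          fun _ _ _ => by positivity
    _ = Real.exp (Real.log 2 / 4) ^ m
          * ∏ i, ∑ b : Bool, Real.exp (-(4 * Real.log 2) * (a i - bit b) ^ 2) := by
        rw [← Finset.mul_sum, Finset.prod_univ_sum, Fintype.piFinset_univ]
    _ ≤ Real.exp (Real.log 2 / 4) ^ m * ∏ _i : Fin m, (3 / 2 : ℝ) := by
        gcongr with i
        exact sum_bool_exp_le (a i)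
    _ = _ := by rw [Finset.prod_const, Finset.card_univ, Fintype.card_fin, mul_pow]

/-- The claim is 2^{1/4} < 4/3, which holds because (4/3)⁴ = 256/81 > 2. Nearby vertices thus form
an exponentially small fraction of the cube. -/
theorem cube_ratio_lt_one : Real.exp (Real.log 2 / 4) * (3 / 2) / 2 < 1 := by
  have h : Real.exp (Real.log 2 / 4) ^ 4 = 2 := by
    rw [← Real.exp_nat_mul]
    push_cast
    rw [mul_div_cancel₀ _ (by norm_num : (4 : ℝ) ≠ 0), Real.exp_log (by norm_num)]
  have h0 := Real.exp_pos (Real.log 2 / 4)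
  by_contra! hc
  have h1 : (4 / 3 : ℝ) ≤ Real.exp (Real.log 2 / 4) := by linarith
  have h2 : (4 / 3 : ℝ) ^ 4 ≤ Real.exp (Real.log 2 / 4) ^ 4 := by gcongr
  rw [h] at h2
  norm_num at h2

/-! ### Bernoulli responses -/

namespace NPIV

noncomputable section

set_option linter.unusedSectionVars false

variable {EX EZ : Type*} [MeasurableSpace EX] [MeasurableSpace EZ]

/-- Append the response `y` to the pair `(x, z)`. -/
def appendResponse (y : ℝ) (q : EX × EZ) : EX × EZ × ℝ := (q.1, q.2, y)

@[fun_prop]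
theorem measurable_appendResponse (y : ℝ) :
    Measurable (appendResponse y : EX × EZ → EX × EZ × ℝ) := by
  unfold appendResponse
  fun_prop

/-- The law of `(X, Z, Y)` where `Y = ± s` is a fair coin independent of `(X, Z) ∼ Q`. -/
def coinLaw (Q : Measure (EX × EZ)) (s : ℝ) : Measure (EX × EZ × ℝ) :=
  (2⁻¹ : ℝ≥0∞) • (Q.map (appendResponse s) + Q.map (appendResponse (-s)))

/-- The density that tilts the coin so that its mean given `Z = z` becomes `f z`. -/
def tilt (s : ℝ) (f : EZ → ℝ) (w : EX × EZ × ℝ) : ℝ≥0∞ :=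
  ENNReal.ofReal (1 + w.2.2 * f w.2.1 / s ^ 2)

/-- The law of `(X, Z, Y)` with `(X, Z) ∼ Q` and `Y = ± s` with mean `f z` given `Z = z`. -/
def tiltedLaw (Q : Measure (EX × EZ)) (s : ℝ) (f : EZ → ℝ) : Measure (EX × EZ × ℝ) :=
  (coinLaw Q s).withDensity (tilt s f)

theorem measurable_tilt {s : ℝ} {f : EZ → ℝ} (hf : Measurable f) :
    Measurable (tilt s f : EX × EZ × ℝ → ℝ≥0∞) := by
  unfold tilt
  fun_prop

theorem lintegral_coinLaw (Q : Measure (EX × EZ)) (s : ℝ) {g : EX × EZ × ℝ → ℝ≥0∞}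
    (hg : Measurable g) :
    ∫⁻ w, g w ∂coinLaw Q s
      = 2⁻¹ * ∫⁻ q, (g (appendResponse s q) + g (appendResponse (-s) q)) ∂Q := by
  rw [coinLaw, lintegral_smul_measure, lintegral_add_measure, lintegral_map hg (by fun_prop),
    lintegral_map hg (by fun_prop), lintegral_add_left (by fun_prop), smul_eq_mul]

theorem ae_coinLaw {Q : Measure (EX × EZ)} {s : ℝ} {φ : EX × EZ × ℝ → Prop}
    (hφ : MeasurableSet {w | φ w}) (h₁ : ∀ q, φ (appendResponse s q))
    (h₂ : ∀ q, φ (appendResponse (-s) q)) : ∀ᵐ w ∂coinLaw Q s, φ w := by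
  rw [coinLaw]
  refine Measure.ae_smul_measure ?_ _
  rw [ae_add_measure_iff, ae_map_iff (by fun_prop) hφ, ae_map_iff (by fun_prop) hφ]
  exact ⟨.of_forall h₁, .of_forall h₂⟩

instance (Q : Measure (EX × EZ)) [IsProbabilityMeasure Q] (s : ℝ) :
    IsProbabilityMeasure (coinLaw Q s) := by
  constructor
  have := lintegral_coinLaw Q s (g := fun _ => 1) measurable_const
  simp only [lintegral_const, measure_univ, one_mul, mul_one] at this
  rw [this, one_add_one_eq_two, ENNReal.inv_mul_cancel (by simp) (by simp)]

theorem tilt_pos {s : ℝ} (hs : 0 < s) (f : EZ → ℝ) (q : EX × EZ) :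
    tilt s f (appendResponse s q) = ENNReal.ofReal (1 + f q.2 / s) := by
  simp only [tilt, appendResponse]
  congr 2
  field_simp

theorem tilt_neg {s : ℝ} (hs : 0 < s) (f : EZ → ℝ) (q : EX × EZ) :
    tilt s f (appendResponse (-s) q) = ENNReal.ofReal (1 - f q.2 / s) := by
  simp only [tilt, appendResponse]
  congr 1
  field_simp
  ring

variable {Q : Measure (EX × EZ)} {s : ℝ} {f : EZ → ℝ}

theorem abs_div_le_one (hs : 0 < s) (hfs : ∀ z, |f z| ≤ s) (z : EZ) : |f z / s| ≤ 1 := by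
  rw [abs_div, abs_of_pos hs, div_le_one hs]
  exact hfs z

/-- The linear terms cancel in (1+t)² + (1-t)² = 2(1+t²) with t = f/s. The final 1 + x ≤ exp x puts
the bound in a form that multiplies over observations. -/
theorem lintegral_tilt_sq_le [IsProbabilityMeasure Q] (hs : 0 < s) (hf : Measurable f)
    (hfs : ∀ z, |f z| ≤ s) :
    ∫⁻ w, tilt s f w ^ 2 ∂coinLaw Q s
      ≤ ENNReal.ofReal (Real.exp ((∫ q, f q.2 ^ 2 ∂Q) / s ^ 2)) := by
  rw [lintegral_coinLaw Q s ((measurable_tilt hf).pow_const 2)]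
  have h1 : ∀ q : EX × EZ, tilt s f (appendResponse s q) ^ 2 + tilt s f (appendResponse (-s) q) ^ 2
      = 2 * ENNReal.ofReal (1 + f q.2 ^ 2 / s ^ 2) := by
    intro q
    have hab := abs_le.1 (abs_div_le_one hs hfs q.2)
    rw [tilt_pos hs, tilt_neg hs, ← ENNReal.ofReal_pow (by linarith),
      ← ENNReal.ofReal_pow (by linarith), ← ENNReal.ofReal_add (by positivity) (by positivity),
      ← ENNReal.ofReal_ofNat 2, ← ENNReal.ofReal_mul (by norm_num)]
    congr 1
    ring
  simp_rw [h1]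
  rw [lintegral_const_mul _ (by fun_prop), ← mul_assoc,
    ENNReal.inv_mul_cancel (by simp) (by simp), one_mul]
  have hint : Integrable (fun q : EX × EZ => f q.2 ^ 2 / s ^ 2) Q := by
    refine Integrable.of_bound (C := 1)
      (((hf.comp measurable_snd).pow_const 2).div_const _).aestronglyMeasurable
      (.of_forall fun q => ?_)
    rw [← div_pow, Real.norm_eq_abs, abs_pow]
    exact pow_le_one₀ (abs_nonneg _) (abs_div_le_one hs hfs q.2)
  rw [← ofReal_integral_eq_lintegral_ofReal (f := fun q : EX × EZ => 1 + f q.2 ^ 2 / s ^ 2)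
    ((integrable_const 1).add hint)
    (.of_forall fun q => by simp only [Pi.zero_apply]; positivity)]
  refine ENNReal.ofReal_le_ofReal ?_
  rw [integral_add (integrable_const 1) hint, integral_const, integral_div]
  simp only [probReal_univ, smul_eq_mul, mul_one]
  linarith [Real.add_one_le_exp ((∫ q, f q.2 ^ 2 ∂Q) / s ^ 2)]

/-- The weights 1 ± f/s of the two responses add up to 2, so tilting leaves the law of the pair
unchanged. -/
theorem tiltedLaw_map (hs : 0 < s) (hf : Measurable f) (hfs : ∀ z, |f z| ≤ s) :
    (tiltedLaw Q s f).map (fun w => (w.1, w.2.1)) = Q := by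
  ext S hS
  have hm : Measurable (fun w : EX × EZ × ℝ => (w.1, w.2.1)) := by fun_prop
  rw [Measure.map_apply hm hS, tiltedLaw, withDensity_apply _ (hm hS),
    ← lintegral_indicator (hm hS),
    lintegral_coinLaw Q s ((measurable_tilt hf).indicator (hm hS))]
  have h1 : ∀ q : EX × EZ,
      ((fun w : EX × EZ × ℝ => (w.1, w.2.1)) ⁻¹' S).indicator (tilt s f) (appendResponse s q)
        + ((fun w : EX × EZ × ℝ => (w.1, w.2.1)) ⁻¹' S).indicator (tilt s f)
          (appendResponse (-s) q) = S.indicator (fun _ => 2) q := by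
    intro q
    have hab := abs_le.1 (abs_div_le_one hs hfs q.2)
    by_cases hq : q ∈ S
    · rw [Set.indicator_of_mem hq, Set.indicator_of_mem (by simpa [appendResponse] using hq),
        Set.indicator_of_mem (by simpa [appendResponse] using hq), tilt_pos hs, tilt_neg hs,
        ← ENNReal.ofReal_add (by linarith) (by linarith), ← ENNReal.ofReal_ofNat 2]
      congr 1
      ring
    · rw [Set.indicator_of_notMem hq, Set.indicator_of_notMem (by simpa [appendResponse] using hq),
        Set.indicator_of_notMem (by simpa [appendResponse] using hq), add_zero]
  simp_rw [h1]
  rw [lintegral_indicator hS, setLIntegral_const, ← mul_assoc,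
    ENNReal.inv_mul_cancel (by simp) (by simp), one_mul]

theorem isProbabilityMeasure_tiltedLaw [IsProbabilityMeasure Q] (hs : 0 < s) (hf : Measurable f)
    (hfs : ∀ z, |f z| ≤ s) : IsProbabilityMeasure (tiltedLaw Q s f) := by
  constructor
  have hm : Measurable (fun w : EX × EZ × ℝ => (w.1, w.2.1)) := by fun_prop
  have h := congrArg (fun ν : Measure (EX × EZ) => ν Set.univ)
    (tiltedLaw_map (Q := Q) hs hf hfs)
  simpa [Measure.map_apply hm MeasurableSet.univ] using h

theorem ae_abs_response_le (hs : 0 < s) : ∀ᵐ w ∂tiltedLaw Q s f, |w.2.2| ≤ s := by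
  refine (withDensity_absolutelyContinuous _ _).ae_le ?_
  refine ae_coinLaw (measurableSet_le (by fun_prop) measurable_const) ?_ ?_ <;>
    intro q <;> simp [appendResponse, abs_of_pos hs]

/-- The two branches contribute s + f and f - s, whose mean is f. This identifies the conditional
mean of the response given the instrument. -/
theorem integral_response_indicator [IsProbabilityMeasure Q] (hs : 0 < s) (hf : Measurable f)
    (hfs : ∀ z, |f z| ≤ s) {B : Set EZ} (hB : MeasurableSet B) :
    ∫ w in (fun w : EX × EZ × ℝ => w.2.1) ⁻¹' B, w.2.2 ∂tiltedLaw Q s f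
      = ∫ q in Prod.snd ⁻¹' B, f q.2 ∂Q := by
  have hmB : MeasurableSet ((fun w : EX × EZ × ℝ => w.2.1) ⁻¹' B) :=
    (show Measurable (fun w : EX × EZ × ℝ => w.2.1) by fun_prop) hB
  have hmQ : MeasurableSet ((Prod.snd : EX × EZ → EZ) ⁻¹' B) := measurable_snd hB
  rw [tiltedLaw, restrict_withDensity hmB, integral_withDensity_eq_integral_toReal_smul
    (measurable_tilt hf) (.of_forall fun w => ENNReal.ofReal_lt_top), ← integral_indicator hmB,
    ← integral_indicator hmQ, coinLaw, integral_smul_measure]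
  set g := ((fun w : EX × EZ × ℝ => w.2.1) ⁻¹' B).indicator
    (fun w => (tilt s f w).toReal • w.2.2) with hg
  have hgm : Measurable g := by
    refine Measurable.indicator ?_ hmB
    exact (measurable_tilt hf).ennreal_toReal.smul (by fun_prop)
  have hpos : ∀ q : EX × EZ, g (appendResponse s q)
      = (Prod.snd ⁻¹' B).indicator (fun q : EX × EZ => s + f q.2) q := by
    intro q
    have hab := abs_le.1 (abs_div_le_one hs hfs q.2)
    by_cases hq : q.2 ∈ B
    · rw [hg, Set.indicator_of_mem (by simpa [appendResponse] using hq),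
        Set.indicator_of_mem (by simpa using hq), tilt_pos hs,
        ENNReal.toReal_ofReal (by linarith)]
      simp only [appendResponse, smul_eq_mul]
      field_simp
    · rw [hg, Set.indicator_of_notMem (by simpa [appendResponse] using hq),
        Set.indicator_of_notMem (by simpa using hq)]
  have hneg : ∀ q : EX × EZ, g (appendResponse (-s) q)
      = (Prod.snd ⁻¹' B).indicator (fun q : EX × EZ => f q.2 - s) q := by
    intro q
    have hab := abs_le.1 (abs_div_le_one hs hfs q.2)
    by_cases hq : q.2 ∈ B
    · rw [hg, Set.indicator_of_mem (by simpa [appendResponse] using hq),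
        Set.indicator_of_mem (by simpa using hq), tilt_neg hs,
        ENNReal.toReal_ofReal (by linarith)]
      simp only [appendResponse, smul_eq_mul]
      field_simp
      ring
    · rw [hg, Set.indicator_of_notMem (by simpa [appendResponse] using hq),
        Set.indicator_of_notMem (by simpa using hq)]
  have hfi : Integrable (fun q : EX × EZ => f q.2) Q :=
    Integrable.of_bound (C := s) (hf.comp measurable_snd).aestronglyMeasurable
      (.of_forall fun q => hfs q.2)
  have hi1 : Integrable ((Prod.snd ⁻¹' B).indicator (fun q : EX × EZ => s + f q.2)) Q :=
    ((integrable_const s).add hfi).indicator hmQ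
  have hi2 : Integrable ((Prod.snd ⁻¹' B).indicator (fun q : EX × EZ => f q.2 - s)) Q :=
    (hfi.sub (integrable_const s)).indicator hmQ
  rw [integral_add_measure, integral_map (by fun_prop) hgm.aestronglyMeasurable,
    integral_map (by fun_prop) hgm.aestronglyMeasurable]
  · simp_rw [hpos, hneg]
    rw [← integral_add hi1 hi2, ← integral_smul]
    refine integral_congr_ae (.of_forall fun q => ?_)
    by_cases hq : q.2 ∈ B
    · simp only [smul_eq_mul, ENNReal.toReal_inv, ENNReal.toReal_ofNat]
      rw [Set.indicator_of_mem (by simpa using hq), Set.indicator_of_mem (by simpa using hq),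
        Set.indicator_of_mem (by simpa using hq)]
      ring
    · simp [Set.indicator, hq]
  · rw [integrable_map_measure hgm.aestronglyMeasurable (by fun_prop)]
    exact hi1.congr (.of_forall fun q => (hpos q).symm)
  · rw [integrable_map_measure hgm.aestronglyMeasurable (by fun_prop)]
    exact hi2.congr (.of_forall fun q => (hneg q).symm)

theorem sigmaZ_le : sigmaZ EX EZ ≤ (inferInstance : MeasurableSpace (EX × EZ × ℝ)) :=
  Measurable.comap_le (by fun_prop)

theorem integrable_response [IsProbabilityMeasure Q] (hs : 0 < s) (hf : Measurable f)
    (hfs : ∀ z, |f z| ≤ s) : Integrable (fun w => w.2.2) (tiltedLaw Q s f) := by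
  have := isProbabilityMeasure_tiltedLaw (Q := Q) hs hf hfs
  exact Integrable.of_bound (C := s)
    (measurable_snd.comp measurable_snd).aestronglyMeasurable (ae_abs_response_le hs)

theorem integral_comp_snd_restrict (hs : 0 < s) (hf : Measurable f)
    (hfs : ∀ z, |f z| ≤ s) {B : Set EZ} (hB : MeasurableSet B) {g : EX × EZ → ℝ}
    (hg : AEStronglyMeasurable g Q) :
    ∫ w in (fun w : EX × EZ × ℝ => w.2.1) ⁻¹' B, g (w.1, w.2.1) ∂tiltedLaw Q s f
      = ∫ q in Prod.snd ⁻¹' B, g q ∂Q := by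
  have hm : Measurable (fun w : EX × EZ × ℝ => (w.1, w.2.1)) := by fun_prop
  have hmap := tiltedLaw_map (Q := Q) hs hf hfs
  conv_rhs => rw [← hmap]
  rw [setIntegral_map (measurable_snd hB) (by rwa [hmap]) hm.aemeasurable]
  rfl

theorem condExp_response [IsProbabilityMeasure Q] (hs : 0 < s) (hf : Measurable f)
    (hfs : ∀ z, |f z| ≤ s) :
    (tiltedLaw Q s f)[fun w => w.2.2 | sigmaZ EX EZ] =ᵐ[tiltedLaw Q s f] fun w => f w.2.1 := by
  have := isProbabilityMeasure_tiltedLaw (Q := Q) hs hf hfs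
  have hfm : Measurable (fun w : EX × EZ × ℝ => f w.2.1) := by fun_prop
  have hfi : Integrable (fun w : EX × EZ × ℝ => f w.2.1) (tiltedLaw Q s f) :=
    Integrable.of_bound (C := s) hfm.aestronglyMeasurable (.of_forall fun w => hfs w.2.1)
  refine (ae_eq_condExp_of_forall_setIntegral_eq sigmaZ_le (integrable_response hs hf hfs)
    (fun _ _ _ => hfi.integrableOn) ?_ ?_).symm
  · rintro _ ⟨B, hB, rfl⟩ -
    rw [integral_response_indicator hs hf hfs hB]
    exact integral_comp_snd_restrict hs hf hfs hB (g := fun q => f q.2)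
      (hf.comp measurable_snd).aestronglyMeasurable
  · exact (hf.comp (comap_measurable _)).stronglyMeasurable.aestronglyMeasurable

end

end NPIV

/-! ### The conditional mean embedding -/

/-- Distinct orthonormal vectors are √2 apart, so balls of radius 1/2 around them are disjoint. -/
theorem Orthonormal.countable {ι E : Type*} [NormedAddCommGroup E] [InnerProductSpace ℝ E]
    [TopologicalSpace.SeparableSpace E] {v : ι → E} (hv : Orthonormal ℝ v) : Countable ι := by
  refine Pairwise.countable_of_isOpen_disjoint (s := fun i => Metric.ball (v i) (1 / 2)) ?_
    (fun i => Metric.isOpen_ball) fun i => ⟨v i, Metric.mem_ball_self (by norm_num)⟩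
  intro i j hij
  refine Metric.ball_disjoint_ball ?_
  have h : ‖v i - v j‖ ^ 2 = 2 := by
    rw [norm_sub_sq_real, hv.1 i, hv.1 j, hv.2 hij]
    norm_num
  rw [dist_eq_norm]
  nlinarith [norm_nonneg (v i - v j)]

/-- **Pettis' theorem** for separable Hilbert spaces. -/
theorem aestronglyMeasurable_of_inner {α E : Type*} [MeasurableSpace α] [NormedAddCommGroup E]
    [InnerProductSpace ℝ E] [CompleteSpace E] [TopologicalSpace.SeparableSpace E]
    {ν : Measure α} {F : α → E} (hF : ∀ v : E, AEMeasurable (fun x => ⟪v, F x⟫_ℝ) ν) :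
    AEStronglyMeasurable F ν := by
  obtain ⟨w, b, -⟩ := exists_hilbertBasis ℝ E
  have : Countable w := b.orthonormal.countable
  refine aestronglyMeasurable_of_tendsto_ae (u := atTop)
    (f := fun (t : Finset w) x => ∑ i ∈ t, ⟪b i, F x⟫_ℝ • b i) ?_ ?_
  · intro t
    refine Finset.aestronglyMeasurable_fun_sum _ fun i _ => ?_
    exact (hF _).aestronglyMeasurable.smul_const _
  · refine .of_forall fun x => ?_
    have := b.hasSum_repr (F x)
    simp_rw [b.repr_apply_apply] at this
    exact this

namespace NPIV

set_option linter.unusedSectionVars false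

variable {EX EZ : Type*} [MeasurableSpace EX] [MeasurableSpace EZ]
variable {H : Type*} [NormedAddCommGroup H] [InnerProductSpace ℝ H] [CompleteSpace H]
  [RKHS ℝ H EX ℝ]
variable {πX : Measure EX} {πZ : Measure EZ} {p : Kernel EZ EX} {κX : ℝ}

theorem ae_kernel_of_ae (hbind : πZ.bind p = πX) {φ : EX → Prop} (h : ∀ᵐ x ∂πX, φ x) :
    ∀ᵐ z ∂πZ, ∀ᵐ x ∂p z, φ x := by
  subst hbind
  exact Measure.ae_ae_of_ae_comp h

/-- A `πX`-null set is `p z`-null for `πZ`-almost every z, so g may be replaced by a measurable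
version under the integral. -/
theorem aestronglyMeasurable_kernelIntegral {E : Type*} [NormedAddCommGroup E] [NormedSpace ℝ E]
    [IsMarkovKernel p]
    (hbind : πZ.bind p = πX) {g : EX → E} (hg : AEStronglyMeasurable g πX) :
    AEStronglyMeasurable (fun z => ∫ x, g x ∂p z) πZ := by
  refine ⟨fun z => ∫ x, hg.mk g x ∂p z, hg.stronglyMeasurable_mk.integral_kernel, ?_⟩
  filter_upwards [ae_kernel_of_ae hbind hg.ae_eq_mk] with z hz using integral_congr_ae hz

theorem aestronglyMeasurable_feature (hk : KernelAssumptions H πX κX) :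
    AEStronglyMeasurable (feature H) πX := by
  have := hk.separable
  refine aestronglyMeasurable_of_inner fun v => ?_
  simp_rw [real_inner_comm _ v, inner_feature]
  exact aemeasurable_coe hk v

theorem ae_norm_feature_le (hk : KernelAssumptions H πX κX) :
    ∀ᵐ x ∂πX, ‖feature H x‖ ≤ |κX| := by
  filter_upwards [hk.bounded] with x hx
  have h1 : ‖feature H x‖ ^ 2 ≤ κX ^ 2 := by
    rw [← real_inner_self_eq_norm_sq, inner_feature]
    exact hx
  simpa using sq_le_sq.mp h1

theorem ae_integrable_feature [IsMarkovKernel p] (hk : KernelAssumptions H πX κX)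
    (hbind : πZ.bind p = πX) : ∀ᵐ z ∂πZ, Integrable (feature H) (p z) := by
  have hmk := (aestronglyMeasurable_feature hk).ae_eq_mk
  filter_upwards [ae_kernel_of_ae hbind hmk, ae_kernel_of_ae hbind (ae_norm_feature_le hk)]
    with z h1 h2
  exact Integrable.of_bound
    ⟨_, (aestronglyMeasurable_feature hk).stronglyMeasurable_mk, h1⟩ _ h2

/-- The exceptional set of z does not depend on f: it only concerns integrability of the feature
map. -/
theorem ae_inner_meanEmbedding [IsMarkovKernel p] (hk : KernelAssumptions H πX κX)
    (hbind : πZ.bind p = πX) :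
    ∀ᵐ z ∂πZ, ∀ f : H, ⟪meanEmbedding H p z, f⟫_ℝ = condMean p f z := by
  filter_upwards [ae_integrable_feature hk hbind] with z hz f
  rw [meanEmbedding, real_inner_comm, ← integral_inner hz, condMean]
  refine integral_congr_ae (.of_forall fun x => ?_)
  simp only
  rw [real_inner_comm, inner_feature]

theorem ae_norm_meanEmbedding_le [IsMarkovKernel p] (hk : KernelAssumptions H πX κX)
    (hbind : πZ.bind p = πX) : ∀ᵐ z ∂πZ, ‖meanEmbedding H p z‖ ≤ |κX| := by
  filter_upwards [ae_kernel_of_ae hbind (ae_norm_feature_le hk)] with z hz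
  simpa [meanEmbedding] using norm_integral_le_of_norm_le_const hz

theorem ae_abs_condMean_le [IsMarkovKernel p] (hk : KernelAssumptions H πX κX)
    (hbind : πZ.bind p = πX) (f : H) : ∀ᵐ z ∂πZ, |condMean p f z| ≤ |κX| * ‖f‖ := by
  filter_upwards [ae_kernel_of_ae hbind (ae_bound hk f)] with z hz
  simpa [condMean] using norm_integral_le_of_norm_le_const hz

theorem aestronglyMeasurable_condMean [IsMarkovKernel p] (hk : KernelAssumptions H πX κX)
    (hbind : πZ.bind p = πX) (f : H) : AEStronglyMeasurable (condMean p f) πZ :=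
  aestronglyMeasurable_kernelIntegral hbind (aemeasurable_coe hk f).aestronglyMeasurable

/-- `⟨C_F f, f⟩ = E[(𝒯 f)(Z)²]`. -/
theorem inner_opF [IsProbabilityMeasure πZ] [IsMarkovKernel p] (hk : KernelAssumptions H πX κX)
    (hbind : πZ.bind p = πX) (f : H) :
    ⟪opF H πZ p f, f⟫_ℝ = ∫ z, condMean p f z ^ 2 ∂πZ := by
  have hF : AEStronglyMeasurable (meanEmbedding H p) πZ :=
    aestronglyMeasurable_kernelIntegral hbind (aestronglyMeasurable_feature hk)
  have hcont : Continuous fun v : H => InnerProductSpace.rankOne ℝ v v :=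
    (InnerProductSpace.rankOne ℝ).continuous.clm_apply continuous_id
  have hint : Integrable (fun z => InnerProductSpace.rankOne ℝ (meanEmbedding H p z)
      (meanEmbedding H p z)) πZ := by
    refine Integrable.of_bound (C := |κX| * |κX|) (hcont.comp_aestronglyMeasurable hF) ?_
    filter_upwards [ae_norm_meanEmbedding_le hk hbind] with z hz
    rw [InnerProductSpace.norm_rankOne]
    gcongr
  rw [opF, ContinuousLinearMap.integral_apply hint, real_inner_comm,
    ← integral_inner (hint.apply_continuousLinearMap f)]
  refine integral_congr_ae ?_
  filter_upwards [ae_inner_meanEmbedding hk hbind] with z hz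
  rw [InnerProductSpace.rankOne_apply, inner_smul_right, real_inner_comm (meanEmbedding H p z) f, hz]
  ring

/-- A bounded version of `𝒯 h` that is measurable everywhere. -/
theorem exists_condMean_version [IsMarkovKernel p] (hk : KernelAssumptions H πX κX)
    (hbind : πZ.bind p = πX) (h : H) {c : ℝ} (hc : |κX| * ‖h‖ ≤ c) :
    ∃ f : EZ → ℝ, Measurable f ∧ (∀ z, |f z| ≤ c) ∧ f =ᵐ[πZ] condMean p h := by
  have hm := aestronglyMeasurable_condMean hk hbind h
  have hc0 : 0 ≤ c := le_trans (by positivity) hc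
  -- Truncation to [-c, c] alters the version only on a null set, and makes the bound hold at every
  -- z, as the tilt requires.
  refine ⟨fun z => max (-c) (min c (hm.mk _ z)),
    measurable_const.max (measurable_const.min hm.stronglyMeasurable_mk.measurable), ?_, ?_⟩
  · intro z
    rw [abs_le]
    exact ⟨le_max_left _ _, max_le (by linarith) (min_le_left _ _)⟩
  · filter_upwards [hm.ae_eq_mk, ae_abs_condMean_le hk hbind h] with z h1 h2
    have h3 := abs_le.1 (h2.trans hc)
    rw [← h1, min_eq_right h3.2, max_eq_right h3.1]

end NPIV

/-! ### The NPIV model with Bernoulli responses -/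

namespace NPIV

noncomputable section

set_option linter.unusedSectionVars false

variable {EX EZ : Type*} [MeasurableSpace EX] [MeasurableSpace EZ]
variable {H : Type*} [NormedAddCommGroup H] [InnerProductSpace ℝ H] [CompleteSpace H]
  [RKHS ℝ H EX ℝ]
variable {πX : Measure EX} {πZ : Measure EZ} {p : Kernel EZ EX} {κX : ℝ}

/-- The joint law of `(X, Z)`. -/
def jointLaw (πZ : Measure EZ) (p : Kernel EZ EX) : Measure (EX × EZ) :=
  (πZ ⊗ₘ p).map Prod.swap

instance [IsProbabilityMeasure πZ] [IsMarkovKernel p] : IsProbabilityMeasure (jointLaw πZ p) :=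
  Measure.isProbabilityMeasure_map measurable_swap.aemeasurable

theorem jointLaw_map_swap : (jointLaw πZ p).map Prod.swap = πZ ⊗ₘ p := by
  rw [jointLaw, Measure.map_map measurable_swap measurable_swap]
  simp

theorem jointLaw_map_snd [IsProbabilityMeasure πZ] [IsMarkovKernel p] :
    (jointLaw πZ p).map Prod.snd = πZ := by
  rw [jointLaw, Measure.map_map measurable_snd measurable_swap]
  exact Measure.fst_compProd πZ p

theorem jointLaw_map_fst [IsProbabilityMeasure πZ] [IsMarkovKernel p] :
    (jointLaw πZ p).map Prod.fst = πZ.bind p := by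
  rw [jointLaw, Measure.map_map measurable_fst measurable_swap]
  exact Measure.snd_compProd πZ p

variable {s : ℝ} {f : EZ → ℝ}

theorem tiltedLaw_map_instrument [IsProbabilityMeasure πZ] [IsMarkovKernel p] (hs : 0 < s)
    (hf : Measurable f) (hfs : ∀ z, |f z| ≤ s) :
    (tiltedLaw (jointLaw πZ p) s f).map (fun w => w.2.1) = πZ := by
  conv_rhs => rw [← jointLaw_map_snd (πZ := πZ) (p := p),
    ← tiltedLaw_map (Q := jointLaw πZ p) hs hf hfs]
  rw [Measure.map_map measurable_snd (by fun_prop)]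
  rfl

theorem tiltedLaw_map_regressor [IsProbabilityMeasure πZ] [IsMarkovKernel p]
    (hbind : πZ.bind p = πX) (hs : 0 < s)
    (hf : Measurable f) (hfs : ∀ z, |f z| ≤ s) :
    (tiltedLaw (jointLaw πZ p) s f).map (fun w => w.1) = πX := by
  conv_rhs => rw [← hbind, ← jointLaw_map_fst (πZ := πZ) (p := p),
    ← tiltedLaw_map (Q := jointLaw πZ p) hs hf hfs]
  rw [Measure.map_map measurable_fst (by fun_prop)]
  rfl

/-- The set where `g₁ = g₂` need not be measurable, so the forward direction passes through
measurable versions. -/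
theorem ae_tiltedLaw_iff_instrument [IsProbabilityMeasure πZ] [IsMarkovKernel p] (hs : 0 < s)
    (hf : Measurable f) (hfs : ∀ z, |f z| ≤ s) {g₁ g₂ : EZ → ℝ} (hg₁ : AEMeasurable g₁ πZ)
    (hg₂ : AEMeasurable g₂ πZ) :
    (∀ᵐ w ∂tiltedLaw (jointLaw πZ p) s f, g₁ w.2.1 = g₂ w.2.1) ↔ g₁ =ᵐ[πZ] g₂ := by
  have hmap := tiltedLaw_map_instrument (πZ := πZ) (p := p) hs hf hfs
  have hm : Measurable (fun w : EX × EZ × ℝ => w.2.1) := by fun_prop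
  constructor
  · intro h
    have h₁ : ∀ᵐ w ∂tiltedLaw (jointLaw πZ p) s f, g₁ w.2.1 = hg₁.mk g₁ w.2.1 :=
      ae_of_ae_map hm.aemeasurable (by rw [hmap]; exact hg₁.ae_eq_mk)
    have h₂ : ∀ᵐ w ∂tiltedLaw (jointLaw πZ p) s f, g₂ w.2.1 = hg₂.mk g₂ w.2.1 :=
      ae_of_ae_map hm.aemeasurable (by rw [hmap]; exact hg₂.ae_eq_mk)
    have h3 : ∀ᵐ z ∂πZ, hg₁.mk g₁ z = hg₂.mk g₂ z := by
      have key := (ae_map_iff (μ := tiltedLaw (jointLaw πZ p) s f) hm.aemeasurable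
        (measurableSet_eq_fun hg₁.measurable_mk hg₂.measurable_mk)).2 (by
          filter_upwards [h, h₁, h₂] with w e e₁ e₂
          rw [← e₁, ← e₂, e])
      rwa [hmap] at key
    filter_upwards [h3, hg₁.ae_eq_mk, hg₂.ae_eq_mk] with z e e₁ e₂
    rw [e₁, e₂, e]
  · intro h
    exact ae_of_ae_map (p := fun z => g₁ z = g₂ z) hm.aemeasurable (by rw [hmap]; exact h)

/-- `E[h(X) | Z] = (𝒯 h)(Z)`. -/
theorem condExp_regressor [IsProbabilityMeasure πZ] [IsMarkovKernel p]
    (hbind : πZ.bind p = πX) (hs : 0 < s) (hf : Measurable f) (hfs : ∀ z, |f z| ≤ s)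
    {h : EX → ℝ} (hh : Integrable h πX) (hfh : f =ᵐ[πZ] condMean p h) :
    Integrable (fun w : EX × EZ × ℝ => h w.1) (tiltedLaw (jointLaw πZ p) s f) ∧
    (tiltedLaw (jointLaw πZ p) s f)[fun w => h w.1 | sigmaZ EX EZ]
      =ᵐ[tiltedLaw (jointLaw πZ p) s f] fun w => f w.2.1 := by
  have := isProbabilityMeasure_tiltedLaw (Q := jointLaw πZ p) hs hf hfs
  have hhi : Integrable (fun w : EX × EZ × ℝ => h w.1) (tiltedLaw (jointLaw πZ p) s f) := by
    rw [← tiltedLaw_map_regressor (p := p) hbind hs hf hfs] at hh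
    exact hh.comp_measurable (by fun_prop)
  refine ⟨hhi, ?_⟩
  have hfm : Measurable (fun w : EX × EZ × ℝ => f w.2.1) := by fun_prop
  have hfi : Integrable (fun w : EX × EZ × ℝ => f w.2.1) (tiltedLaw (jointLaw πZ p) s f) :=
    Integrable.of_bound (C := s) hfm.aestronglyMeasurable (.of_forall fun w => hfs w.2.1)
  refine (ae_eq_condExp_of_forall_setIntegral_eq sigmaZ_le hhi
    (fun _ _ _ => hfi.integrableOn) ?_ ?_).symm
  · rintro _ ⟨B, hB, rfl⟩ -
    have hQ : Integrable (fun q : EX × EZ => h q.1) (jointLaw πZ p) := by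
      rw [← hbind, ← jointLaw_map_fst (πZ := πZ) (p := p)] at hh
      exact hh.comp_measurable measurable_fst
    have hC : Integrable (fun q : EZ × EX => h q.2) (πZ ⊗ₘ p) := by
      rw [← hbind, ← Measure.snd_compProd πZ p] at hh
      exact hh.comp_measurable measurable_snd
    have e1 := integral_comp_snd_restrict (Q := jointLaw πZ p) hs hf hfs hB hQ.1
    have e2 := setIntegral_map (f := fun z => f z) (g := fun w : EX × EZ × ℝ => w.2.1)
      (μ := tiltedLaw (jointLaw πZ p) s f) hB hf.aestronglyMeasurable (by fun_prop)
    rw [tiltedLaw_map_instrument hs hf hfs] at e2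
    rw [e1, ← e2]
    have e3 : ∫ q in Prod.snd ⁻¹' B, h q.1 ∂jointLaw πZ p
        = ∫ q in B ×ˢ Set.univ, h q.2 ∂(πZ ⊗ₘ p) := by
      have hsub : AEStronglyMeasurable (fun q : EX × EZ => h q.1)
        ((πZ ⊗ₘ p).map Prod.swap) := hQ.1
      rw [jointLaw, setIntegral_map (measurable_snd hB) hsub measurable_swap.aemeasurable,
        Set.prod_univ]
      rfl
    rw [e3, Measure.setIntegral_compProd hB MeasurableSet.univ hC.integrableOn]
    simp_rw [Measure.restrict_univ]
    exact setIntegral_congr_ae hB (hfh.mono fun z hz _ => hz)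
  · exact (hf.comp (comap_measurable _)).stronglyMeasurable.aestronglyMeasurable

variable [IsProbabilityMeasure πX] [IsProbabilityMeasure πZ] [IsMarkovKernel p]

theorem isNPIVModel_tiltedLaw (hbind : πZ.bind p = πX) (hs : 0 < s) (hf : Measurable f)
    (hfs : ∀ z, |f z| ≤ s) {h : EX → ℝ} (hh : MemLp h 2 πX) (hfh : f =ᵐ[πZ] condMean p h) :
    IsNPIVModel πX πZ p (tiltedLaw (jointLaw πZ p) s f) h := by
  have hc := condExp_regressor hbind hs hf hfs (hh.integrable (by norm_num)) hfh
  refine ⟨isProbabilityMeasure_tiltedLaw hs hf hfs, ?_, tiltedLaw_map_regressor hbind hs hf hfs, hh,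
    integrable_response hs hf hfs, ?_⟩
  · rw [← jointLaw_map_swap (πZ := πZ) (p := p)]
    conv_rhs => rw [← tiltedLaw_map (Q := jointLaw πZ p) hs hf hfs]
    rw [Measure.map_map measurable_swap (by fun_prop)]
    rfl
  · refine (condExp_sub (integrable_response hs hf hfs) hc.1 _).trans ?_
    filter_upwards [condExp_response (Q := jointLaw πZ p) hs hf hfs, hc.2] with w h1 h2
    simp [h1, h2]

theorem mem_solutionSet_tiltedLaw_iff (hk : KernelAssumptions H πX κX) (hbind : πZ.bind p = πX)
    (hs : 0 < s) (hf : Measurable f) (hfs : ∀ z, |f z| ≤ s) (h : H) :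
    h ∈ solutionSet H p (tiltedLaw (jointLaw πZ p) s f) ↔ f =ᵐ[πZ] condMean p h := by
  rw [← ae_tiltedLaw_iff_instrument (p := p) hs hf hfs hf.aemeasurable
    (aestronglyMeasurable_condMean hk hbind h).aemeasurable]
  have hc := condExp_response (Q := jointLaw πZ p) hs hf hfs
  constructor
  · intro hh
    filter_upwards [show _ =ᵐ[_] _ from hh, hc] with w h1 h2
    rw [← h2, h1]
  · intro hh
    change _ =ᵐ[_] _
    filter_upwards [hh, hc] with w h1 h2
    rw [h2, h1]

theorem embX_ae_eq (hk : KernelAssumptions H πX κX) (h : H) : embX hk h =ᵐ[πX] h :=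
  (memLp_coe hk h).coeFn_toLp

theorem condMean_embX_ae_eq (hk : KernelAssumptions H πX κX) (hbind : πZ.bind p = πX) (h : H) :
    condMean p (embX hk h) =ᵐ[πZ] condMean p h := by
  filter_upwards [ae_kernel_of_ae hbind (embX_ae_eq hk h)] with z hz using integral_congr_ae hz

/-- By completeness any two solutions agree in L², hence differ by an element of the kernel of the
embedding. The solution orthogonal to this kernel has least norm, by Cauchy–Schwarz. -/
theorem isMinNormSolution_tiltedLaw (hk : KernelAssumptions H πX κX) (hbind : πZ.bind p = πX)
    (hcomp : Completeness πX πZ p) (hs : 0 < s) (hf : Measurable f) (hfs : ∀ z, |f z| ≤ s) {h : H}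
    (hfh : f =ᵐ[πZ] condMean p h)
    (horth : h ∈ (LinearMap.ker (embX hk : H →ₗ[ℝ] Lp ℝ 2 πX))ᗮ) :
    IsMinNormSolution p (tiltedLaw (jointLaw πZ p) s f) h := by
  refine ⟨(mem_solutionSet_tiltedLaw_iff hk hbind hs hf hfs h).2 hfh, fun h' hh' => ?_⟩
  rw [mem_solutionSet_tiltedLaw_iff hk hbind hs hf hfs] at hh'
  have heq : embX hk h' = embX hk h := by
    refine hcomp _ _ ?_
    exact ((condMean_embX_ae_eq hk hbind h').trans (hh'.symm.trans hfh)).trans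
      (condMean_embX_ae_eq hk hbind h).symm
  have hker : h' - h ∈ LinearMap.ker (embX hk : H →ₗ[ℝ] Lp ℝ 2 πX) := by
    rw [LinearMap.mem_ker]
    change embX hk (h' - h) = 0
    rw [map_sub, heq, sub_self]
  have h0 : ⟪h, h' - h⟫_ℝ = 0 := (Submodule.mem_orthogonal' _ _).1 horth _ hker
  have h1 : ⟪h, h'⟫_ℝ = ‖h‖ * ‖h‖ := by
    rw [inner_sub_right, real_inner_self_eq_norm_mul_norm] at h0
    linarith
  by_contra! hlt
  nlinarith [real_inner_le_norm h h', norm_nonneg h']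

/-- The residual is at most 2s ≤ min(σ, L) in absolute value, and m! ≥ 2 absorbs the factor 1/2. -/
theorem momentCondition_tiltedLaw (hs : 0 < s) (hf : Measurable f) (hfs : ∀ z, |f z| ≤ s)
    {h : EX → ℝ} (hfh : f =ᵐ[πZ] condMean p h) {σ L : ℝ} (hσ : 2 * s ≤ σ) (hL : 2 * s ≤ L) :
    MomentCondition p (tiltedLaw (jointLaw πZ p) s f) h σ L := by
  have := isProbabilityMeasure_tiltedLaw (Q := jointLaw πZ p) hs hf hfs
  intro m hm
  have hfh' : ∀ᵐ w ∂tiltedLaw (jointLaw πZ p) s f, f w.2.1 = condMean p h w.2.1 :=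
    (ae_tiltedLaw_iff_instrument hs hf hfs hf.aemeasurable
      (hf.aemeasurable.congr hfh)).2 hfh
  set C : ℝ := 1 / 2 * (m.factorial : ℝ) * σ ^ 2 * L ^ (m - 2) with hC
  have hbound : ∀ᵐ w ∂tiltedLaw (jointLaw πZ p) s f, |w.2.2 - condMean p h w.2.1| ^ m ≤ C := by
    filter_upwards [ae_abs_response_le hs, hfh'] with w h1 h2
    have h3 : |w.2.2 - condMean p h w.2.1| ≤ 2 * s := by
      rw [← h2]
      linarith [abs_sub w.2.2 (f w.2.1), hfs w.2.1]
    have hfac : (2 : ℝ) ≤ m.factorial := by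
      exact_mod_cast (Nat.factorial_le hm : Nat.factorial 2 ≤ _)
    have h2s : (2 * s) ^ 2 * (2 * s) ^ (m - 2) ≤ σ ^ 2 * L ^ (m - 2) := by gcongr
    calc |w.2.2 - condMean p h w.2.1| ^ m ≤ (2 * s) ^ m := by gcongr
      _ = (2 * s) ^ 2 * (2 * s) ^ (m - 2) := by rw [← pow_add, Nat.add_sub_cancel' hm]
      _ ≤ σ ^ 2 * L ^ (m - 2) := h2s
      _ ≤ (1 / 2 * (m.factorial : ℝ)) * (σ ^ 2 * L ^ (m - 2)) :=
          le_mul_of_one_le_left (le_trans (by positivity) h2s) (by linarith)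
      _ = C := by rw [hC]; ring
  have hint : Integrable (fun w : EX × EZ × ℝ => |w.2.2 - condMean p h w.2.1| ^ m)
      (tiltedLaw (jointLaw πZ p) s f) := by
    refine Integrable.of_bound (C := C) ?_ ?_
    · have hm' : Measurable fun w : EX × EZ × ℝ => |w.2.2 - f w.2.1| ^ m := by fun_prop
      exact hm'.aestronglyMeasurable.congr (hfh'.mono fun w hw => by simp only [hw])
    · filter_upwards [hbound] with w hw
      rwa [Real.norm_of_nonneg (by positivity)]
  refine ⟨hint, ?_⟩
  have hmono := condExp_mono (m := sigmaZ EX EZ) hint (integrable_const C) hbound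
  rw [condExp_const sigmaZ_le] at hmono
  exact hmono

end

end NPIV

/-! ### Testing the vertices of a cube -/

namespace NPIV

noncomputable section

set_option linter.unusedSectionVars false

/-- The exponential rate of the testing error over a cube. -/
def cubeRate : ℝ := (Real.exp (Real.log 2 / 4) * (3 / 2) / 2) ^ (1 / 4 : ℝ)

theorem cubeRate_pos : 0 < cubeRate := by
  unfold cubeRate
  positivity

theorem cubeRate_lt_one : cubeRate < 1 :=
  Real.rpow_lt_one (by positivity) cube_ratio_lt_one (by norm_num)

theorem cubeRate_pow_four : cubeRate ^ 4 = Real.exp (Real.log 2 / 4) * (3 / 2) / 2 := by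
  rw [cubeRate, ← Real.rpow_natCast, ← Real.rpow_mul (by positivity)]
  norm_num

section Testing

variable {EX EZ : Type*} [MeasurableSpace EX] [MeasurableSpace EZ]

/-- The map `a` estimates ω by an arbitrary point of ℝ^m. The hypothesis `hinfo` keeps the second
moment of each sample likelihood ratio below ρ^{-m}, ρ = `cubeRate`, which the fraction ρ^{4m} of
nearby vertices outweighs. -/
theorem exists_cube_vertex_pi_tiltedLaw_le {Q : Measure (EX × EZ)} [IsProbabilityMeasure Q] {s : ℝ}
    (hs : 0 < s) {m n : ℕ} {f : (Fin m → Bool) → EZ → ℝ} (hf : ∀ ω, Measurable (f ω))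
    (hfs : ∀ ω z, |f ω z| ≤ s)
    (hinfo : ∀ ω, n * ((∫ q, f ω q.2 ^ 2 ∂Q) / s ^ 2) ≤ m * -Real.log cubeRate)
    {a : (Fin n → EX × EZ × ℝ) → Fin m → ℝ} (ha : ∀ i, Measurable fun D => a D i) :
    ∃ ω, (Measure.pi fun _ : Fin n => tiltedLaw Q s (f ω))
        {D | ∑ i, (a D i - bit (ω i)) ^ 2 < m / 16}
      ≤ ENNReal.ofReal (2 * cubeRate ^ m) := by
  classical
  have hρ := cubeRate_pos
  set P₀ : Measure (Fin n → EX × EZ × ℝ) := Measure.pi fun _ => coinLaw Q s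
  set B : (Fin m → Bool) → Set (Fin n → EX × EZ × ℝ) :=
    fun ω => {D | ∑ i, (a D i - bit (ω i)) ^ 2 < m / 16} with hBdef
  have hB : ∀ ω, MeasurableSet (B ω) := fun ω =>
    measurableSet_lt (Finset.measurable_fun_sum _ fun i _ => ((ha i).sub_const _).pow_const 2)
      measurable_const
  have hℓ : ∀ ω, Measurable fun D : Fin n → EX × EZ × ℝ => ∏ i, tilt s (f ω) (D i) := fun ω =>
    Finset.measurable_fun_prod _ fun i _ => (measurable_tilt (hf ω)).comp (measurable_pi_apply i)
  have hV : ∀ ω, ∫⁻ D, (∏ i, tilt s (f ω) (D i)) ^ 2 ∂P₀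
      ≤ ENNReal.ofReal ((cubeRate ^ m)⁻¹) := by
    intro ω
    simp_rw [← Finset.prod_pow]
    rw [lintegral_pi_prod (coinLaw Q s) (f := fun _ w => tilt s (f ω) w ^ 2)
      fun _ => (measurable_tilt (hf ω)).pow_const 2, Finset.prod_const, Finset.card_univ,
      Fintype.card_fin]
    calc (∫⁻ w, tilt s (f ω) w ^ 2 ∂coinLaw Q s) ^ n
        ≤ ENNReal.ofReal (Real.exp ((∫ q, f ω q.2 ^ 2 ∂Q) / s ^ 2)) ^ n := by
          gcongr
          exact lintegral_tilt_sq_le hs (hf ω) (hfs ω)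
      _ = ENNReal.ofReal (Real.exp (n * ((∫ q, f ω q.2 ^ 2 ∂Q) / s ^ 2))) := by
          rw [← ENNReal.ofReal_pow (Real.exp_pos _).le, Real.exp_nat_mul]
      _ ≤ ENNReal.ofReal (Real.exp (m * -Real.log cubeRate)) :=
          ENNReal.ofReal_le_ofReal (Real.exp_le_exp.2 (hinfo ω))
      _ = _ := by rw [Real.exp_nat_mul, Real.exp_neg, Real.exp_log hρ, inv_pow]
  have hN : ∀ D, ∑ ω, (B ω).indicator (1 : (Fin n → EX × EZ × ℝ) → ℝ≥0∞) D
      ≤ ENNReal.ofReal ((cubeRate ^ 4 * 2) ^ m) := by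
    intro D
    have h := card_cube_near_le (a D)
    rw [cubeRate_pow_four, div_mul_cancel₀ _ (by norm_num : (2 : ℝ) ≠ 0)]
    refine le_trans (le_of_eq ?_) (ENNReal.ofReal_le_ofReal h)
    rw [ENNReal.ofReal_natCast]
    simp only [Set.indicator_apply, Pi.one_apply, hBdef, Set.mem_ofPred_eq]
    rw [Finset.sum_boole]
  -- With second moment ρ^{-m} and average probability ρ^{4m}, the level ρ^{2m} yields ρ^m + ρ^{2m}
  -- ≤ 2ρ^m.
  obtain ⟨ω, hω⟩ := exists_withDensity_apply_le P₀ hℓ hB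
    (a := ENNReal.ofReal (cubeRate ^ (2 * m))) (by simpa using by positivity)
    ENNReal.ofReal_ne_top hV hN
  refine ⟨ω, ?_⟩
  have hprob := isProbabilityMeasure_tiltedLaw (Q := Q) hs (hf ω) (hfs ω)
  have hpi : (Measure.pi fun _ : Fin n => tiltedLaw Q s (f ω))
      = P₀.withDensity fun D => ∏ i, tilt s (f ω) (D i) := by
    have : IsProbabilityMeasure ((coinLaw Q s).withDensity (tilt s (f ω))) := hprob
    exact pi_withDensity (coinLaw Q s) (measurable_tilt (hf ω))
  rw [hpi]
  refine hω.trans ?_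
  have hcard : ((Fintype.card (Fin m → Bool) : ℕ) : ℝ≥0∞) = ENNReal.ofReal (2 ^ m) := by
    rw [Fintype.card_fun, Fintype.card_bool, Fintype.card_fin, ENNReal.ofReal_pow (by norm_num)]
    simp
  rw [hcard, ← ENNReal.ofReal_div_of_pos (by positivity), ← ENNReal.ofReal_inv_of_pos (by positivity),
    ← ENNReal.ofReal_mul (by positivity), ← ENNReal.ofReal_mul (by positivity),
    ← ENNReal.ofReal_add (by positivity) (by positivity)]
  refine ENNReal.ofReal_le_ofReal ?_
  have hm : cubeRate ^ m ≠ 0 := by positivity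
  have hm1 : cubeRate ^ m ≤ 1 := pow_le_one₀ hρ.le cubeRate_lt_one.le
  rw [mul_pow, mul_div_assoc, div_self (by positivity : (2 : ℝ) ^ m ≠ 0), mul_one,
    show 2 * m = m * 2 by ring, pow_mul, ← pow_mul cubeRate 4 m, show 4 * m = m * 4 by ring,
    pow_mul]
  field_simp
  linarith

end Testing

end

end NPIV

/-! ### Finite combinations of eigenfunctions -/

theorem Orthonormal.norm_sq_sum_smul {ι κ E : Type*} [Fintype κ] [NormedAddCommGroup E]
    [InnerProductSpace ℝ E] {v : ι → E} (hv : Orthonormal ℝ v) {k : κ → ι}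
    (hk : Function.Injective k) (c : κ → ℝ) : ‖∑ i, c i • v (k i)‖ ^ 2 = ∑ i, c i ^ 2 := by
  have h := (hv.comp k hk).inner_sum c c Finset.univ
  rw [← real_inner_self_eq_norm_sq]
  simp only [Function.comp] at h
  rw [h]
  simp [sq]

theorem NPIV.fracPow_sum_smul {κ E : Type*} [Fintype κ] [NormedAddCommGroup E]
    [InnerProductSpace ℝ E] {v : ℕ → E} (hv : Orthonormal ℝ v) (μ : ℕ → ℝ) (t : ℝ) (k : κ → ℕ)
    (c : κ → ℝ) :
    NPIV.fracPow μ v t (∑ i, c i • v (k i)) = ∑ i, (μ (k i) ^ t * c i) • v (k i) := by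
  have h1 : ∀ i, HasSum (fun j => (μ j ^ t * ⟪v j, c i • v (k i)⟫_ℝ) • v j)
      ((μ (k i) ^ t * c i) • v (k i)) := by
    intro i
    have h := hasSum_single (f := fun j => (μ j ^ t * ⟪v j, c i • v (k i)⟫_ℝ) • v j) (k i)
      fun j hj => by rw [inner_smul_right, hv.2 hj, mul_zero, mul_zero, zero_smul]
    simp only [inner_smul_right, real_inner_self_eq_norm_sq, hv.1, one_pow, mul_one] at h
    simpa only [inner_smul_right] using h
  have h2 := hasSum_sum (s := Finset.univ) fun i _ => h1 i
  rw [NPIV.fracPow, ← h2.tsum_eq]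
  congr 1
  ext j
  rw [inner_sum, Finset.mul_sum, Finset.sum_smul]

namespace NPIV

variable {EX : Type*} [MeasurableSpace EX]
variable {H : Type*} [NormedAddCommGroup H] [InnerProductSpace ℝ H] [CompleteSpace H]
  [RKHS ℝ H EX ℝ] {πX : Measure EX} [IsProbabilityMeasure πX] {κX : ℝ}
  {hk : KernelAssumptions H πX κX} {μ : ℕ → ℝ} {e : ℕ → H}

theorem IsSpectralSystem.smul_eq (hsys : IsSpectralSystem hk μ e) (a : ℝ) (j : ℕ) :
    a • e j = (a / Real.sqrt (μ j)) • (Real.sqrt (μ j) • e j) := by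
  rw [smul_smul, div_mul_cancel₀ _ (Real.sqrt_pos.2 (hsys.pos j)).ne']

variable {κ : Type*} [Fintype κ] {k : κ → ℕ}

theorem IsSpectralSystem.sum_mem_orthogonal (hsys : IsSpectralSystem hk μ e) (a : κ → ℝ) :
    ∑ i, a i • e (k i) ∈ (LinearMap.ker (embX hk : H →ₗ[ℝ] Lp ℝ 2 πX))ᗮ := by
  rw [← hsys.dense_H]
  refine Submodule.le_topologicalClosure _ (Submodule.sum_mem _ fun i _ => ?_)
  rw [hsys.smul_eq]
  exact Submodule.smul_mem _ _ (Submodule.subset_span ⟨k i, rfl⟩)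

theorem IsSpectralSystem.norm_sq_sum (hsys : IsSpectralSystem hk μ e) (hinj : Function.Injective k)
    (a : κ → ℝ) : ‖∑ i, a i • e (k i)‖ ^ 2 = ∑ i, a i ^ 2 / μ (k i) := by
  simp_rw [hsys.smul_eq (a _)]
  rw [hsys.orthonormal_H.norm_sq_sum_smul hinj]
  refine Finset.sum_congr rfl fun i _ => ?_
  rw [div_pow, Real.sq_sqrt (hsys.pos _).le]

theorem IsSpectralSystem.norm_sq_fracPow_sum (hsys : IsSpectralSystem hk μ e)
    (hinj : Function.Injective k) (a : κ → ℝ) (γ : ℝ) :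
    ‖fracPow μ (fun i => Real.sqrt (μ i) • e i) (γ / 2) (∑ i, a i • e (k i))‖ ^ 2
      = ∑ i, μ (k i) ^ (γ - 1) * a i ^ 2 := by
  simp_rw [hsys.smul_eq (a _)]
  rw [fracPow_sum_smul hsys.orthonormal_H μ (γ / 2) k (fun i => a i / Real.sqrt (μ (k i))),
    hsys.orthonormal_H.norm_sq_sum_smul hinj]
  refine Finset.sum_congr rfl fun i _ => ?_
  have hμ := hsys.pos (k i)
  rw [mul_pow, div_pow, Real.sq_sqrt hμ.le, ← Real.rpow_natCast, ← Real.rpow_mul hμ.le,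
    Real.rpow_sub hμ, Real.rpow_one]
  norm_num
  ring

theorem IsSpectralSystem.interpNorm_sum_le (hsys : IsSpectralSystem hk μ e)
    (hinj : Function.Injective k) (a : κ → ℝ) {β b : ℝ} (hb : 0 ≤ b)
    (hab : ∑ i, μ (k i) ^ (-β) * a i ^ 2 ≤ b ^ 2) :
    interpNorm hk μ e β (embX hk (∑ i, a i • e (k i))) ≤ ENNReal.ofReal b := by
  -- An explicit preimage under L_X^{β/2}; as the interpolation norm is an infimum over preimages,
  -- its norm is an upper bound.
  set u : Lp ℝ 2 πX := ∑ i, (μ (k i) ^ (-(β / 2)) * a i) • embX hk (e (k i)) with hu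
  have hfrac : fracPow μ (fun i => embX hk (e i)) (β / 2) u = embX hk (∑ i, a i • e (k i)) := by
    rw [hu, fracPow_sum_smul hsys.orthonormal_L2 μ (β / 2) k
      (fun i => μ (k i) ^ (-(β / 2)) * a i), map_sum]
    refine Finset.sum_congr rfl fun i _ => ?_
    have hμ := hsys.pos (k i)
    rw [map_smul, ← mul_assoc, ← Real.rpow_add hμ, add_neg_cancel, Real.rpow_zero, one_mul]
  refine (iInf₂_le u hfrac).trans ?_
  rw [← ofReal_norm]
  refine ENNReal.ofReal_le_ofReal ((sq_le_sq₀ (norm_nonneg _) hb).1 (le_trans (le_of_eq ?_) hab))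
  rw [hu, hsys.orthonormal_L2.norm_sq_sum_smul hinj]
  refine Finset.sum_congr rfl fun i _ => ?_
  have hμ := hsys.pos (k i)
  rw [mul_pow, ← Real.rpow_natCast, ← Real.rpow_mul hμ.le]
  norm_num

/-- Bessel's inequality: only the block coefficients of an estimator matter, which reduces the
problem to ℝ^m. -/
theorem IsSpectralSystem.sum_sq_coeff_sub_le (hsys : IsSpectralSystem hk μ e)
    (hinj : Function.Injective k) (a : κ → ℝ) (g : Lp ℝ 2 πX) :
    ∑ i, (⟪embX hk (e (k i)), g⟫_ℝ - a i) ^ 2 ≤ ‖g - embX hk (∑ i, a i • e (k i))‖ ^ 2 := by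
  have hv := hsys.orthonormal_L2.comp k hinj
  have h := hv.sum_inner_products_le (g - embX hk (∑ i, a i • e (k i))) (s := Finset.univ)
  refine le_trans (le_of_eq (Finset.sum_congr rfl fun i _ => ?_)) h
  rw [inner_sub_right, map_sum]
  simp_rw [map_smul]
  have h2 := hv.inner_right_fintype a i
  simp only [Function.comp] at h2 ⊢
  rw [h2, Real.norm_eq_abs, sq_abs]

end NPIV

/-! ### Power counting on a block of eigenvalues -/

namespace NPIV

theorem EigenvalueDecay.block_bounds {μ : ℕ → ℝ} {c₂ c₃ p : ℝ} (hd : EigenvalueDecay μ c₂ c₃ p)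
    (hp : 0 < p) (hc₂ : 0 < c₂) (hc₃ : 0 < c₃) {m i : ℕ} (hm : 0 < m) (hi : i < m) :
    c₃ * (2 * m : ℝ) ^ (-(1 / p)) ≤ μ (m + i) ∧ μ (m + i) ≤ c₂ * (m : ℝ) ^ (-(1 / p)) := by
  have hm' : (0 : ℝ) < m := by exact_mod_cast hm
  -- The index starts at 0, so the base in the decay condition is m + i + 1, which lies between m
  -- and 2m.
  have hi' : (i : ℝ) + 1 ≤ m := by exact_mod_cast hi
  have hp' : -(1 / p) ≤ 0 := by
    have := one_div_pos.2 hp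
    linarith
  obtain ⟨h1, h2⟩ := hd (m + i)
  push_cast at h1 h2
  constructor
  · refine le_trans ?_ h1
    gcongr ?_ * ?_
    exact Real.rpow_le_rpow_of_nonpos (by positivity) (by linarith) hp'
  · refine h2.trans ?_
    gcongr ?_ * ?_
    exact Real.rpow_le_rpow_of_nonpos hm' (by linarith [(Nat.cast_nonneg i : (0 : ℝ) ≤ i)]) hp'

section Block

variable {μ : ℕ → ℝ} {c₂ c₃ p β b : ℝ} {m : ℕ} {a : Fin m → ℝ}

/-- The squared amplitude is calibrated to the smallest eigenvalue allowed on the block, so that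
each of the m terms costs at most b²/m. -/
theorem sum_source_le (hd : EigenvalueDecay μ c₂ c₃ p) (hp : 0 < p) (hc₂ : 0 < c₂) (hc₃ : 0 < c₃)
    (hβ : 1 ≤ β) (hm : 0 < m)
    (ha : ∀ i, a i ^ 2 ≤ b ^ 2 * c₃ ^ β * (2 * m : ℝ) ^ (-(β / p)) / m) :
    ∑ i : Fin m, μ (m + i) ^ (-β) * a i ^ 2 ≤ b ^ 2 := by
  have hm' : (0 : ℝ) < m := by exact_mod_cast hm
  have hterm : ∀ i : Fin m, μ (m + i) ^ (-β) * a i ^ 2 ≤ b ^ 2 / m := by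
    intro i
    have h1 := (hd.block_bounds hp hc₂ hc₃ hm i.2).1
    have h2 : μ (m + i) ^ (-β) ≤ (c₃ * (2 * m : ℝ) ^ (-(1 / p))) ^ (-β) :=
      Real.rpow_le_rpow_of_nonpos (by positivity) h1 (by linarith)
    have h3 : (c₃ * (2 * m : ℝ) ^ (-(1 / p))) ^ (-β) * (c₃ ^ β * (2 * m : ℝ) ^ (-(β / p))) = 1 := by
      rw [Real.mul_rpow hc₃.le (by positivity), ← Real.rpow_mul (by positivity)]
      have e1 : -(1 / p) * -β = β / p := by ring
      rw [e1, mul_mul_mul_comm, ← Real.rpow_add hc₃, ← Real.rpow_add (by positivity)]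
      simp
    calc μ (m + i) ^ (-β) * a i ^ 2
        ≤ (c₃ * (2 * m : ℝ) ^ (-(1 / p))) ^ (-β)
            * (b ^ 2 * c₃ ^ β * (2 * m : ℝ) ^ (-(β / p)) / m) := by
          gcongr
          exact ha i
      _ = ((c₃ * (2 * m : ℝ) ^ (-(1 / p))) ^ (-β) * (c₃ ^ β * (2 * m : ℝ) ^ (-(β / p))))
            * (b ^ 2 / m) := by ring
      _ = b ^ 2 / m := by rw [h3, one_mul]
  calc ∑ i : Fin m, μ (m + i) ^ (-β) * a i ^ 2 ≤ ∑ _i : Fin m, b ^ 2 / m :=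
        Finset.sum_le_sum fun i _ => hterm i
    _ = b ^ 2 := by
        rw [Finset.sum_const, Finset.card_univ, Fintype.card_fin, nsmul_eq_mul]
        field_simp

/-- For β ≥ 1 the source norm controls the RKHS norm, uniformly in m. This is what keeps 𝒯 h within
[-s, s]. -/
theorem sum_div_le (hpos : ∀ i, 0 < μ i) (hanti : Antitone μ) (hβ : 1 ≤ β)
    (hab : ∑ i : Fin m, μ (m + i) ^ (-β) * a i ^ 2 ≤ b ^ 2) :
    ∑ i : Fin m, a i ^ 2 / μ (m + i) ≤ μ 0 ^ (β - 1) * b ^ 2 := by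
  have h0 : 0 ≤ μ 0 ^ (β - 1) := Real.rpow_nonneg (hpos 0).le _
  refine le_trans ?_ (mul_le_mul_of_nonneg_left hab h0)
  rw [Finset.mul_sum]
  refine Finset.sum_le_sum fun i _ => ?_
  have hμ := hpos (m + i)
  have h1 : μ (m + i) ^ (β - 1) ≤ μ 0 ^ (β - 1) :=
    Real.rpow_le_rpow hμ.le (hanti (Nat.zero_le _)) (by linarith)
  calc a i ^ 2 / μ (m + i) = μ (m + i) ^ (β - 1) * (μ (m + i) ^ (-β) * a i ^ 2) := by
        rw [← mul_assoc, ← Real.rpow_add hμ, show β - 1 + -β = -1 by ring, Real.rpow_neg_one]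
        ring
    _ ≤ _ := by
        gcongr

/-- The exponent γ - 1 is nonnegative, so the upper eigenvalue bound applies; the factor 1/m in the
amplitude offsets the m terms. -/
theorem sum_link_le {γ : ℝ} (hd : EigenvalueDecay μ c₂ c₃ p) (hpos : ∀ i, 0 < μ i) (hp : 0 < p)
    (hc₂ : 0 < c₂) (hc₃ : 0 < c₃) (hγ : 1 ≤ γ) (hm : 0 < m)
    (ha : ∀ i, a i ^ 2 ≤ b ^ 2 * c₃ ^ β * (2 * m : ℝ) ^ (-(β / p)) / m) :
    ∑ i : Fin m, μ (m + i) ^ (γ - 1) * a i ^ 2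
      ≤ c₃ ^ β * 2 ^ (-(β / p)) * c₂ ^ (γ - 1) * b ^ 2 * (m : ℝ) ^ (-((β + γ - 1) / p)) := by
  have hm' : (0 : ℝ) < m := by exact_mod_cast hm
  have hterm : ∀ i : Fin m, μ (m + i) ^ (γ - 1) * a i ^ 2
      ≤ c₃ ^ β * 2 ^ (-(β / p)) * c₂ ^ (γ - 1) * b ^ 2 * (m : ℝ) ^ (-((β + γ - 1) / p)) / m := by
    intro i
    have h1 := (hd.block_bounds hp hc₂ hc₃ hm i.2).2
    have h2 : μ (m + i) ^ (γ - 1) ≤ (c₂ * (m : ℝ) ^ (-(1 / p))) ^ (γ - 1) :=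
      Real.rpow_le_rpow (hpos _).le h1 (by linarith)
    calc μ (m + i) ^ (γ - 1) * a i ^ 2
        ≤ (c₂ * (m : ℝ) ^ (-(1 / p))) ^ (γ - 1)
            * (b ^ 2 * c₃ ^ β * (2 * m : ℝ) ^ (-(β / p)) / m) := by
          gcongr
          exact ha i
      _ = c₃ ^ β * 2 ^ (-(β / p)) * c₂ ^ (γ - 1) * b ^ 2
            * ((m : ℝ) ^ (-(1 / p) * (γ - 1)) * (m : ℝ) ^ (-(β / p))) / m := by
          rw [Real.mul_rpow hc₂.le (by positivity), ← Real.rpow_mul hm'.le,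
            Real.mul_rpow (by norm_num) hm'.le]
          ring
      _ = _ := by
          rw [← Real.rpow_add hm']
          congr 3
          ring
  calc ∑ i : Fin m, μ (m + i) ^ (γ - 1) * a i ^ 2
      ≤ ∑ _i : Fin m, _ := Finset.sum_le_sum fun i _ => hterm i
    _ = _ := by
        rw [Finset.sum_const, Finset.card_univ, Fintype.card_fin, nsmul_eq_mul]
        field_simp

end Block

theorem exists_small_radius {B A₁ A₂ δ₁ δ₂ : ℝ} (hB : 0 < B) (hδ₁ : 0 < δ₁) (hδ₂ : 0 < δ₂) :
    ∃ b : ℝ, 0 < b ∧ b ≤ B ∧ A₁ * b ^ 2 ≤ δ₁ ∧ A₂ * b ^ 2 ≤ δ₂ := by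
  have h : ∀ A δ : ℝ, 0 < δ → ∀ᶠ b : ℝ in nhdsWithin 0 (Set.Ioi 0), A * b ^ 2 ≤ δ := by
    intro A δ hδ
    have hc : Tendsto (fun b : ℝ => A * b ^ 2) (nhds 0) (nhds 0) := by
      have : Continuous fun b : ℝ => A * b ^ 2 := by fun_prop
      simpa using this.tendsto 0
    exact ((hc.mono_left nhdsWithin_le_nhds).eventually_lt_const hδ).mono fun _ h => h.le
  have hpos : ∀ᶠ b : ℝ in nhdsWithin 0 (Set.Ioi 0), 0 < b := self_mem_nhdsWithin
  have hle : ∀ᶠ b : ℝ in nhdsWithin 0 (Set.Ioi 0), b ≤ B :=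
    nhdsWithin_le_nhds (eventually_le_nhds hB)
  obtain ⟨b, h1, h2, h3, h4⟩ := (hpos.and (hle.and ((h A₁ δ₁ hδ₁).and (h A₂ δ₂ hδ₂)))).exists
  exact ⟨b, h1, h2, h3, h4⟩

theorem bit_sq_le_one (x : Bool) : bit x ^ 2 ≤ 1 := by
  cases x <;> simp [bit]

end NPIV

/-! ### The lower bound -/

theorem theorem5
    {EX : Type u} [TopologicalSpace EX] [SecondCountableTopology EX] [LocallyCompactSpace EX]
    [T2Space EX] [MeasurableSpace EX] [BorelSpace EX]
    {H : Type w} [NormedAddCommGroup H] [InnerProductSpace ℝ H] [CompleteSpace H]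
    [RKHS ℝ H EX ℝ]
    (πX : Measure EX) [IsProbabilityMeasure πX]
    (κX : ℝ) (hk : KernelAssumptions H πX κX)
    (μ : ℕ → ℝ) (e : ℕ → H) (hsys : IsSpectralSystem hk μ e)
    (pX c₂ c₃ : ℝ) (hpX : 0 < pX) (hpX1 : pX ≤ 1) (hc₂ : 0 < c₂) (hc₃ : 0 < c₃)
    (hevd : EigenvalueDecay μ c₂ c₃ pX)
    (γ₁ R₁ : ℝ) (hγ₁ : 1 ≤ γ₁) (hR₁ : 0 < R₁)
    (βX : ℝ) (hβX : 1 ≤ βX)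
    (σ L BX : ℝ) (hσ : 0 < σ) (hL : 0 < L) (hBX : 0 < BX) :
    ∃ J₀ J θ : ℝ, 0 < J₀ ∧ 0 < J ∧ 0 < θ ∧
      ∀ (EZ : Type v) [TopologicalSpace EZ] [SecondCountableTopology EZ] [LocallyCompactSpace EZ]
        [T2Space EZ] [MeasurableSpace EZ] [BorelSpace EZ]
        (πZ : Measure EZ) [IsProbabilityMeasure πZ] (p : Kernel EZ EX) [IsMarkovKernel p],
        πZ.bind p = πX →
        Completeness πX πZ p →
        UpperLink μ e πZ p γ₁ R₁ →
        ∀ A : (n : ℕ) → (Fin n → EX × EZ × ℝ) → Lp ℝ 2 πX,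
          (∀ n, StronglyMeasurable (A n)) →
          ∀ τ : ℝ, 0 < τ → ∀ᶠ n : ℕ in atTop,
            ∃ (P : Measure (EX × EZ × ℝ)) (h₀ : EX → ℝ) (hstar : H),
              IsNPIVModel πX πZ p P h₀ ∧
              IsMinNormSolution p P hstar ∧
              interpNorm hk μ e βX (embX hk hstar) ≤ ENNReal.ofReal BX ∧
              MomentCondition p P hstar σ L ∧
              1 - J₀ * τ ^ (1 / θ) ≤
                (Measure.pi (fun _ : Fin n => P)).real
                  {D | τ ^ 2 * J * (n : ℝ) ^ (-(βX / (βX + γ₁ - 1 + pX)))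
                    ≤ ‖A n D - embX hk hstar‖ ^ 2} := by
  set s : ℝ := min σ L / 2 with hs_def
  have hs : 0 < s := by rw [hs_def]; exact half_pos (lt_min hσ hL)
  have hsσ : 2 * s ≤ σ := by rw [hs_def]; linarith [min_le_left σ L]
  have hsL : 2 * s ≤ L := by rw [hs_def]; linarith [min_le_right σ L]
  have hρ := cubeRate_pos
  have hρ1 := cubeRate_lt_one
  have hδ : 0 < -Real.log cubeRate := by linarith [Real.log_neg hρ hρ1]
  set D : ℝ := βX + γ₁ - 1 + pX with hD_def
  have hD : 0 < D := by rw [hD_def]; linarith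
  set K : ℝ := c₃ ^ βX * 2 ^ (-(βX / pX)) * c₂ ^ (γ₁ - 1) with hK_def
  -- The radius b does not depend on n or on the instrument. Its two constraints give |κ_X| ‖h_ω‖ ≤
  -- s and the information bound.
  obtain ⟨b, hb, hbB, hbκ, hbK⟩ := exists_small_radius (A₁ := κX ^ 2 * μ 0 ^ (βX - 1))
    (A₂ := R₁ ^ 2 * K / s ^ 2) hBX (pow_pos hs 2) hδ
  -- The 4 comes from 2m ≤ 4 n^{p_X/D}, and the 16 from the radius m/16 in the cube. Since the error
  -- probability tends to 0, J₀ = θ = 1 suffices.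
  refine ⟨1, b ^ 2 * c₃ ^ βX * 4 ^ (-(βX / pX)) / 16, 1, one_pos, by positivity, one_pos, ?_⟩
  intro EZ _ _ _ _ _ _ πZ _ p _ hbind hcomp hlink A hA τ hτ
  have hceil : Tendsto (fun n : ℕ => ⌈(n : ℝ) ^ (pX / D)⌉₊) atTop atTop :=
    tendsto_nat_ceil_atTop.comp
      ((tendsto_rpow_atTop (div_pos hpX hD)).comp tendsto_natCast_atTop_atTop)
  have herr : Tendsto (fun n : ℕ => 2 * cubeRate ^ ⌈(n : ℝ) ^ (pX / D)⌉₊) atTop (nhds 0) := by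
    simpa using ((tendsto_pow_atTop_nhds_zero_of_lt_one hρ.le hρ1).comp hceil).const_mul 2
  filter_upwards [eventually_ge_atTop 1, herr.eventually_lt_const hτ] with n hn hnτ
  have hn1 : (1 : ℝ) ≤ n := by exact_mod_cast hn
  have hn0 : (0 : ℝ) < n := by linarith
  -- This block length balances the information n · m^{-(β_X+γ₁-1)/p_X} against the dimension m.
  set m : ℕ := ⌈(n : ℝ) ^ (pX / D)⌉₊ with hm_def
  have hnp : 1 ≤ (n : ℝ) ^ (pX / D) := Real.one_le_rpow hn1 (by positivity)
  have hmge : (n : ℝ) ^ (pX / D) ≤ m := Nat.le_ceil _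
  have hmle : (m : ℝ) ≤ 2 * (n : ℝ) ^ (pX / D) := by
    linarith [Nat.ceil_lt_add_one (show (0 : ℝ) ≤ (n : ℝ) ^ (pX / D) by positivity)]
  have hm' : (0 : ℝ) < m := by linarith
  have hm : 0 < m := by exact_mod_cast hm'
  have hnm : (n : ℝ) ≤ (m : ℝ) ^ (D / pX) := by
    calc (n : ℝ) = ((n : ℝ) ^ (pX / D)) ^ (D / pX) := by
          rw [← Real.rpow_mul hn0.le, div_mul_div_cancel₀ hD.ne', div_self hpX.ne', Real.rpow_one]
      _ ≤ _ := Real.rpow_le_rpow (by positivity) hmge (by positivity)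
  set ε : ℝ := Real.sqrt (b ^ 2 * c₃ ^ βX * (2 * m : ℝ) ^ (-(βX / pX)) / m) with hε_def
  have hε2 : ε ^ 2 = b ^ 2 * c₃ ^ βX * (2 * m : ℝ) ^ (-(βX / pX)) / m :=
    Real.sq_sqrt (by positivity)
  have hε : 0 < ε := Real.sqrt_pos.2 (by positivity)
  have hinj : Function.Injective fun i : Fin m => m + (i : ℕ) := fun i j hij =>
    Fin.ext (Nat.add_left_cancel hij)
  set a : (Fin m → Bool) → Fin m → ℝ := fun ω i => ε * bit (ω i) with ha_def
  set h : (Fin m → Bool) → H := fun ω => ∑ i, a ω i • e (m + i) with hh_def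
  have ha2 : ∀ ω i, a ω i ^ 2 ≤ b ^ 2 * c₃ ^ βX * (2 * m : ℝ) ^ (-(βX / pX)) / m := by
    intro ω i
    rw [← hε2, ha_def]
    simp only
    rw [mul_pow]
    exact mul_le_of_le_one_right (by positivity) (bit_sq_le_one _)
  have hsource := fun ω => sum_source_le hevd hpX hc₂ hc₃ hβX hm (ha2 ω)
  have hnorm : ∀ ω, |κX| * ‖h ω‖ ≤ s := by
    intro ω
    refine (sq_le_sq₀ (by positivity) hs.le).1 ?_
    rw [mul_pow, sq_abs, hh_def, hsys.norm_sq_sum hinj]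
    refine le_trans ?_ hbκ
    rw [mul_assoc]
    exact mul_le_mul_of_nonneg_left (sum_div_le hsys.pos hsys.antitone hβX (hsource ω))
      (sq_nonneg _)
  choose f hf hfs hfh using fun ω => exists_condMean_version hk hbind (h ω) (hnorm ω)
  have hinfo : ∀ ω, n * ((∫ q, f ω q.2 ^ 2 ∂jointLaw πZ p) / s ^ 2) ≤ m * -Real.log cubeRate := by
    intro ω
    have h1 : ∫ q, f ω q.2 ^ 2 ∂jointLaw πZ p = ⟪opF H πZ p (h ω), h ω⟫_ℝ := by
      have hsq : ∫ z, f ω z ^ 2 ∂πZ = ∫ z, condMean p (h ω) z ^ 2 ∂πZ :=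
        integral_congr_ae ((hfh ω).fun_comp fun t => t ^ 2)
      rw [inner_opF hk hbind, ← hsq]
      conv_rhs => rw [← jointLaw_map_snd (πZ := πZ) (p := p)]
      rw [integral_map measurable_snd.aemeasurable
        (((hf ω).pow_const 2).aestronglyMeasurable)]
    have h2 : ⟪opF H πZ p (h ω), h ω⟫_ℝ
        ≤ R₁ ^ 2 * (K * b ^ 2 * (m : ℝ) ^ (-((βX + γ₁ - 1) / pX))) := by
      refine le_trans (Real.sqrt_le_left (by positivity) |>.1 (hlink (h ω))) ?_
      rw [mul_pow, hh_def, hsys.norm_sq_fracPow_sum hinj]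
      exact mul_le_mul_of_nonneg_left
        (sum_link_le hevd hsys.pos hpX hc₂ hc₃ hγ₁ hm (ha2 ω)) (sq_nonneg _)
    have h3 : (n : ℝ) * (m : ℝ) ^ (-((βX + γ₁ - 1) / pX)) ≤ m := by
      calc (n : ℝ) * (m : ℝ) ^ (-((βX + γ₁ - 1) / pX))
          ≤ (m : ℝ) ^ (D / pX) * (m : ℝ) ^ (-((βX + γ₁ - 1) / pX)) := by gcongr
        _ = (m : ℝ) ^ (1 : ℝ) := by
            rw [← Real.rpow_add hm']
            congr 1
            rw [hD_def]
            field_simp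
            ring
        _ = m := Real.rpow_one _
    rw [h1]
    calc n * (⟪opF H πZ p (h ω), h ω⟫_ℝ / s ^ 2)
        ≤ n * ((R₁ ^ 2 * (K * b ^ 2 * (m : ℝ) ^ (-((βX + γ₁ - 1) / pX)))) / s ^ 2) := by gcongr
      _ = (n * (m : ℝ) ^ (-((βX + γ₁ - 1) / pX))) * (R₁ ^ 2 * K / s ^ 2 * b ^ 2) := by ring
      _ ≤ m * -Real.log cubeRate := by gcongr
  -- Dividing the block coefficients of the estimator by ε puts them on the scale of the unit cube.
  obtain ⟨ω, hω⟩ := exists_cube_vertex_pi_tiltedLaw_le hs hf hfs hinfo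
    (a := fun D i => ⟪embX hk (e (m + i)), A n D⟫_ℝ / ε) fun i =>
      ((stronglyMeasurable_const.inner (hA n)).measurable).div_const _
  have hprob := isProbabilityMeasure_tiltedLaw (Q := jointLaw πZ p) hs (hf ω) (hfs ω)
  refine ⟨tiltedLaw (jointLaw πZ p) s (f ω), h ω, h ω,
    isNPIVModel_tiltedLaw hbind hs (hf ω) (hfs ω) (memLp_coe hk _) (hfh ω),
    isMinNormSolution_tiltedLaw hk hbind hcomp hs (hf ω) (hfs ω) (hfh ω)
      (hsys.sum_mem_orthogonal (k := fun i : Fin m => m + (i : ℕ)) (a ω)),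
    (hsys.interpNorm_sum_le hinj (a ω) hb.le (hsource ω)).trans (ENNReal.ofReal_le_ofReal hbB),
    momentCondition_tiltedLaw hs (hf ω) (hfs ω) (hfh ω) hsσ hsL, ?_⟩
  rw [one_mul, div_one, Real.rpow_one]
  -- For τ > 1 the required probability 1 - τ is negative.
  rcases lt_or_ge 1 τ with hτ1 | hτ1
  · exact le_trans (by linarith) measureReal_nonneg
  set P := Measure.pi fun _ : Fin n => tiltedLaw (jointLaw πZ p) s (f ω)
  set r : ℝ := τ ^ 2 * (b ^ 2 * c₃ ^ βX * 4 ^ (-(βX / pX)) / 16) * (n : ℝ) ^ (-(βX / D)) with hr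
  have hrε : r ≤ ε ^ 2 * (m / 16) := by
    have h1 : (4 : ℝ) ^ (-(βX / pX)) * (n : ℝ) ^ (-(βX / D)) ≤ (2 * m : ℝ) ^ (-(βX / pX)) := by
      have e1 : (n : ℝ) ^ (-(βX / D)) = ((n : ℝ) ^ (pX / D)) ^ (-(βX / pX)) := by
        rw [← Real.rpow_mul hn0.le]
        congr 1
        field_simp
      rw [e1, ← Real.mul_rpow (by norm_num) (by positivity)]
      refine Real.rpow_le_rpow_of_nonpos (by positivity) (by linarith) ?_
      have : 0 < βX / pX := div_pos (by linarith) hpX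
      linarith
    have h2 : τ ^ 2 ≤ 1 := pow_le_one₀ hτ.le hτ1
    calc r = τ ^ 2 * (b ^ 2 * c₃ ^ βX / 16
            * ((4 : ℝ) ^ (-(βX / pX)) * (n : ℝ) ^ (-(βX / D)))) := by rw [hr]; ring
      _ ≤ 1 * (b ^ 2 * c₃ ^ βX / 16 * (2 * m : ℝ) ^ (-(βX / pX))) := by gcongr
      _ = _ := by
        rw [hε2]
        field_simp
  have hmeas : MeasurableSet {D | r ≤ ‖A n D - embX hk (h ω)‖ ^ 2} :=
    measurableSet_le measurable_const
      ((((hA n).sub stronglyMeasurable_const).norm.measurable).pow_const 2)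
  have hbad : P.real {D | r ≤ ‖A n D - embX hk (h ω)‖ ^ 2}ᶜ ≤ τ := by
    refine le_trans ?_ hnτ.le
    refine ENNReal.toReal_le_of_le_ofReal (by positivity) (le_trans (measure_mono ?_) hω)
    -- If the estimator is too accurate, its rescaled coefficients are within squared distance m/16
    -- of ω, the event of small probability in `hω`.
    intro D hDlt
    have hlt : ‖A n D - embX hk (h ω)‖ ^ 2 < r := not_le.1 hDlt
    have hbessel := hsys.sum_sq_coeff_sub_le hinj (a ω) (A n D)
    have hscale : ∑ i : Fin m, (⟪embX hk (e (m + i)), A n D⟫_ℝ - a ω i) ^ 2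
        = ε ^ 2 * ∑ i : Fin m, (⟪embX hk (e (m + i)), A n D⟫_ℝ / ε - bit (ω i)) ^ 2 := by
      rw [Finset.mul_sum]
      refine Finset.sum_congr rfl fun i _ => ?_
      rw [← mul_pow, mul_sub, mul_div_cancel₀ _ hε.ne']
    have hfin := (hbessel.trans_lt hlt).trans_le hrε
    rw [hscale] at hfin
    exact lt_of_mul_lt_mul_left hfin (sq_nonneg ε)
  rw [probReal_compl_eq_one_sub hmeas] at hbad
  linarith
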